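/- Let $d\ge 1$, $H\in(\tfrac12,1)$, $0<\alpha<d$, and let $\mu$ be a tempered non-negative measure on $\mathbb{R}^d$ with $\mu(d\xi)\asymp|\xi|^{-\alpha}d\xi$, i.e. for every measurable $h\ge 0$ with $\int h(\xi)|\xi|^{-\alpha}d\xi<\infty$ there are constants $C,C'\in(0,\infty)$, possibly depending on $h$, with $$C'\int h(\xi)|\xi|^{-\alpha}d\xi\le\int h\,d\mu\le C\int h(\xi)|\xi|^{-\alpha}d\xi .$$ Assume also $\int_{\mathbb{R}^d}(1+|\xi|^2)^{-2H}\mu(d\xi)<\infty$ (the condition for existence of the mild solution of the heat equation below). Let the function $f:\mathbb{R}^d\to\mathbb{R}$ be the Fourier transform of $\mu$, i.e. $\int f\varphi\,dx=\int\mathcal{F}\varphi\,d\mu$ for all Schwartz $\varphi$, where $\mathcal{F}\varphi(\xi)=\int e^{-i\langle\xi,x\rangle}\varphi(x)dx$. Let $W^H=\{W^H(t,A)\}$, $t\in\mathbb{R}$, $A\subset\mathbb{R}^d$ bounded Borel, be a centered Gaussian field with $$\mathbb{E}\big(W^H(t,A)W^H(s,B)\big)=\tfrac12\big(|t|^{2H}+|s|^{2H}-|t-s|^{2H}\big)\int_A\int_B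 f(z-z')\,dz\,dz' .$$ Let $G(t,x)=(2\pi t)^{-d/2}e^{-|x|^2/(2t)}$ for $t>0$ and $G(t,x)=0$ for $t\le 0$. Fix $x\in\mathbb{R}^d$ and put, for $t\ge 0$, $$Y(t)=\int_{-\infty}^0\int_{\mathbb{R}^d}\big(G(t-u,x-y)-G(-u,x-y)\big)\,W^H(du,dy),$$ a Wiener integral: the map $\mathbf 1_{(s,t]\times A}\mapsto W^H(t,A)-W^H(s,A)$ is extended linearly to step functions and then, by $L^2$-limits, to integrands $g(u,y)$ that are limits of step functions in the norm $$\|g\|^2=H(2H-1)\int\mu(d\xi)\int_{\mathbb{R}}\int_{\mathbb{R}}|u-v|^{2H-2}\,\mathcal{F}g(u,\cdot)(\xi)\,\overline{\mathcal{F}g(v,\cdot)(\xi)}\,du\,dv .$$ (The process $Y$ is the remainder in the decomposition $u(t,x)=U(t)-Y(t)$ of the mild solution $u$ of $\partial_t u=\tfrac12\Delta u+\dot W^H$, $u(0,\cdot)=0$, where $U$ is the pinned string process.) Let $[a,b]\subset(0,\infty)$. Then for every $k\ge 1$ there is a modification of $\{Y(t),t\ge 0\}$ whose sample function is almost surely $k$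 times continuously differentiable on $[a,b]$. -/

import Mathlib

open MeasureTheory ProbabilityTheory Filter Topology
open scoped ENNReal NNReal SchwartzMap

noncomputable section

namespace FracHeat

/-- The space `ℝ^d` with its Euclidean norm and inner product. -/
abbrev Space (d : ℕ) : Type := EuclideanSpace ℝ (Fin d)

/-- The Fourier transform `(𝓕 g)(ξ) = ∫ e^{-i⟨ξ, x⟩} g(x) dx` (no `2π` in the exponent). -/
def fourier {d : ℕ} (g : Space d → ℂ) (ξ : Space d) : ℂ :=
  ∫ x, Complex.exp (-(Complex.I * ((inner ℝ ξ x : ℝ) : ℂ))) * g x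

/-- The heat kernel `G(t, x)`, the fundamental solution of `∂ₜ - Δ/2`, zero for `t ≤ 0`. -/
def heatKernel {d : ℕ} (t : ℝ) (x : Space d) : ℝ :=
  if 0 < t then (2 * Real.pi * t) ^ (-(d : ℝ) / 2) * Real.exp (-‖x‖ ^ 2 / (2 * t)) else 0

/-- A tempered non-negative measure: `∫ (1 + |ξ|²)^{-l} μ(dξ) < ∞` for some `l > 0`. -/
def IsTempered {d : ℕ} (μ : Measure (Space d)) : Prop :=
  ∃ l : ℝ, 0 < l ∧ ∫⁻ ξ, ENNReal.ofReal ((1 / (1 + ‖ξ‖ ^ 2)) ^ l) ∂μ < ∞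

/-- The function `f` is the Fourier transform of `μ`: it acts on Schwartz functions by
(absolutely convergent) integration, and `∫ f φ dx = ∫ 𝓕φ dμ` for all of them. -/
def IsFourierTransformOf {d : ℕ} (f : Space d → ℝ) (μ : Measure (Space d)) : Prop :=
  ∀ φ : 𝓢(Space d, ℂ),
    Integrable (fun x => (f x : ℂ) * φ x) ∧
      ∫ x, (f x : ℂ) * φ x = ∫ ξ, fourier (fun x => φ x) ξ ∂μ

/-- The measure `|ξ|^{-α} dξ`. -/
def rieszMeasure (d : ℕ) (α : ℝ) : Measure (Space d) :=
  volume.withDensity fun ξ => ENNReal.ofReal (‖ξ‖ ^ (-α))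

/-- `μ(dξ) ≍ |ξ|^{-α} dξ`: for every non-negative measurable `h` (with `∫ h |ξ|^{-α} dξ` finite)
the integrals of `h` against the two measures are comparable, up to positive finite constants
that may depend on `h`. -/
def AsympRiesz {d : ℕ} (μ : Measure (Space d)) (α : ℝ) : Prop :=
  ∀ h : Space d → ℝ≥0, Measurable h → ∫⁻ ξ, h ξ ∂(rieszMeasure d α) < ∞ →
    ∃ C' C : ℝ≥0, 0 < C' ∧ 0 < C ∧
      C' * ∫⁻ ξ, h ξ ∂(rieszMeasure d α) ≤ ∫⁻ ξ, h ξ ∂μ ∧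
      ∫⁻ ξ, h ξ ∂μ ≤ C * ∫⁻ ξ, h ξ ∂(rieszMeasure d α)

/-- The existence condition `∫ (1 / (1 + |ξ|²))^{2H} μ(dξ) < ∞` for the mild solution. -/
def ExistenceCondition {d : ℕ} (H : ℝ) (μ : Measure (Space d)) : Prop :=
  ∫⁻ ξ, ENNReal.ofReal ((1 / (1 + ‖ξ‖ ^ 2)) ^ (2 * H)) ∂μ < ∞

/-- The bounded Borel subsets of `ℝ^d`. -/
def BoundedBorel (d : ℕ) : Type :=
  {A : Set (Space d) // MeasurableSet A ∧ Bornology.IsBounded A}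

/-- The covariance function of (two-sided) fractional Brownian motion. -/
def fbmCov (H t s : ℝ) : ℝ :=
  (|t| ^ (2 * H) + |s| ^ (2 * H) - |t - s| ^ (2 * H)) / 2

variable {Ω : Type*} [MeasurableSpace Ω] {d : ℕ}

/-- The fractional-colored noise: a centered Gaussian field `W(t, A)`, `t ∈ ℝ`, `A` bounded Borel,
with `E[W(t, A) W(s, B)] = R_H(t, s) ∫_A ∫_B f(z - z') dz' dz`. -/
structure IsFractionalColoredNoise (H : ℝ) (f : Space d → ℝ)
    (W : ℝ → BoundedBorel d → Ω → ℝ) (P : Measure Ω) : Prop where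
  gaussian : IsGaussianProcess (fun i : ℝ × BoundedBorel d => W i.1 i.2) P
  centered : ∀ t A, ∫ ω, W t A ω ∂P = 0
  covariance : ∀ t s A B,
    ∫ ω, W t A ω * W s B ω ∂P = fbmCov H t s * ∫ z in A.1, ∫ z' in B.1, f (z - z')

/-- A space-time set `(left, right] × base` with bounded Borel base. -/
structure Box (d : ℕ) where
  left : ℝ
  right : ℝ
  left_le_right : left ≤ right
  base : BoundedBorel d

/-- An elementary integrand: a formal linear combination `∑ c_i 1_{(s_i, t_i] × A_i}`. -/
abbrev Elementary (d : ℕ) : Type := Box d →₀ ℝ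

/-- The function `(u, y) ↦ ∑ c_i 1_{(s_i, t_i]}(u) 1_{A_i}(y)`. -/
def Elementary.toFun (φ : Elementary d) (u : ℝ) (y : Space d) : ℝ :=
  φ.sum fun B c =>
    c * ((Set.Ioc B.left B.right).indicator 1 u * B.base.1.indicator 1 y)

/-- The integral `∑ c_i (W(t_i, A_i) - W(s_i, A_i))` of an elementary integrand. -/
def Elementary.integral (W : ℝ → BoundedBorel d → Ω → ℝ) (φ : Elementary d) (ω : Ω) : ℝ :=
  φ.sum fun B c => c * (W B.right B.base ω - W B.left B.base ω)

/-- The Fourier transform in the space variable. -/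
def spaceFourier (g : ℝ → Space d → ℝ) (u : ℝ) (ξ : Space d) : ℂ :=
  fourier (fun y => (g u y : ℂ)) ξ

/-- The squared norm
`α_H ∫ μ(dξ) ∫∫ |u - v|^{2H-2} 𝓕g(u,·)(ξ) conj(𝓕g(v,·)(ξ)) du dv`, `α_H = H(2H-1)`,
of the Hilbert space of integrands of the noise. -/
def normSq (H : ℝ) (μ : Measure (Space d)) (g : ℝ → Space d → ℝ) : ℝ :=
  H * (2 * H - 1) * ∫ ξ, (∫ u : ℝ, ∫ v : ℝ, |u - v| ^ (2 * H - 2) *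
    (spaceFourier g u ξ * (starRingEnd ℂ) (spaceFourier g v ξ)).re) ∂μ

/-- The integrand `g` is measurable, integrable in space at almost every time, and the integral in
`normSq` converges absolutely. -/
structure IsAdmissible (H : ℝ) (μ : Measure (Space d)) (g : ℝ → Space d → ℝ) : Prop where
  measurable : Measurable fun p : ℝ × Space d => g p.1 p.2
  integrable : ∀ᵐ u : ℝ, Integrable (g u)
  abs_lt_top : ∫⁻ ξ, (∫⁻ u : ℝ, ∫⁻ v : ℝ, ENNReal.ofReal (|u - v| ^ (2 * H - 2) *
    (‖spaceFourier g u ξ‖ * ‖spaceFourier g v ξ‖))) ∂μ < ∞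

/-- `X` is (a version of) the Wiener integral `∫∫ g(u, y) W(du, dy)`: the integrals of some
sequence of elementary integrands that tends to `g` in the norm of the space of integrands
tend to `X` in `L²(P)`. -/
def IsWienerIntegral (H : ℝ) (μ : Measure (Space d)) (W : ℝ → BoundedBorel d → Ω → ℝ)
    (P : Measure Ω) (g : ℝ → Space d → ℝ) (X : Ω → ℝ) : Prop :=
  IsAdmissible H μ g ∧ MemLp X 2 P ∧
    ∃ φ : ℕ → Elementary d,
      Tendsto (fun n => normSq H μ fun u y => (φ n).toFun u y - g u y) atTop (𝓝 0) ∧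
      Tendsto (fun n => eLpNorm (fun ω => (φ n).integral W ω - X ω) 2 P) atTop (𝓝 0)

/-- The integrand `1_{u ≤ 0} (G(t - u, x - y) - G(-u, x - y))` of the remainder `Y(t)`. -/
def remainderKernel (x : Space d) (t u : ℝ) (y : Space d) : ℝ :=
  if u ≤ 0 then heatKernel (t - u) (x - y) - heatKernel (-u) (x - y) else 0

end FracHeat

end

open FracHeat

noncomputable section

namespace FracHeat

/-! The remainder depends on $t$ only through heat that has already flowed for time $t>0$. In
Fourier variables its integrand is a factor independent of $t$ times $e^{-t\lambda}-1$, with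
$\lambda=|\xi|^2/2$. This is analytic in $t$, and the proof transports that analyticity to the
random variables $Y(t)$.

The transport is linear. The identity $\int (u-s)_+^{H-3/2}(v-s)_+^{H-3/2}\,ds = c\,|u-v|^{2H-2}$
(`lintegral_fracKernel_mul`) makes `timeTransform`, applied to the spatial Fourier transform, an
isometry up to a constant from integrands into $L^2(\mu\otimes ds)$
(`IsTransformable.integral_norm_sq`). For boxes, the transforms and the noise have proportional Gram
matrices (`gram_boxNoise`). The spatial part of this is the Plancherel identity
`integral_indFourier_mul_conj`, obtained from the distributional relation between $f$ and $\mu$ by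
mollification. Hence a single bounded operator $L^2(\mu\otimes ds)\to L^2(P)$ sends the transform of
every integrand to its Wiener integral (`exists_wiener_operator`).

With $q=1-t/b$, the function $e^{-(1-q)b\lambda}-1$ is a power series in $q$ whose coefficients are
all bounded by $1-e^{-b\lambda}$ in absolute value (`abs_expCoeff_le`). Multiplied by the common
factor, they are therefore dominated by the transform of the integrand at $t=b$, which is in $L^2$
because $Y(b)$ exists. Applying the operator gives $Y(t)=\sum_n q^nX_n$ with $X_n$ bounded in
$L^2(P)$. Such a random power series almost surely converges at one point beyond the range of $q$
for $t\in[a,b]$, so its sum is a smooth modification there (`exists_contDiff_modification`). -/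

/-! ### Factorization of the time covariance -/

/-- The kernel `(u - s)_+ ^ (H - 3/2)` that factorizes the fractional noise in time. -/
def fracKernel (H u s : ℝ) : ℝ := if s < u then (u - s) ^ (H - 3 / 2) else 0

/-- The normalizing constant `∫₀^∞ (r (1 + r)) ^ (H - 3/2) dr`. -/
def kernelConst (H : ℝ) : ℝ≥0∞ :=
  ∫⁻ r in Set.Ioi (0 : ℝ), ENNReal.ofReal ((r * (1 + r)) ^ (H - 3 / 2))

lemma fracKernel_nonneg (H u s : ℝ) : 0 ≤ fracKernel H u s := by
  unfold fracKernel
  split_ifs with h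
  · exact Real.rpow_nonneg (by linarith) _
  · exact le_rfl

lemma measurable_fracKernel (H : ℝ) : Measurable fun p : ℝ × ℝ => fracKernel H p.1 p.2 := by
  unfold fracKernel
  exact Measurable.ite (measurableSet_lt measurable_snd measurable_fst)
    ((measurable_fst.sub measurable_snd).pow_const _) measurable_const

lemma measurable_fracKernel_left (H s : ℝ) : Measurable fun u => fracKernel H u s :=
  (measurable_fracKernel H).comp (measurable_id.prodMk measurable_const)

lemma lintegral_comp_mul_left_real (F : ℝ → ℝ≥0∞) (hF : Measurable F) {w : ℝ} (hw : 0 < w) :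
    ∫⁻ s, F s = ENNReal.ofReal w * ∫⁻ r, F (w * r) := by
  have h := Real.map_volume_mul_left hw.ne'
  have h2 : ∫⁻ r, F (w * r) = ENNReal.ofReal |w⁻¹| * ∫⁻ s, F s := by
    rw [← lintegral_map hF (measurable_const_mul w), h, lintegral_smul_measure, smul_eq_mul]
  rw [h2, ← mul_assoc, ← ENNReal.ofReal_mul hw.le, abs_of_pos (inv_pos.2 hw),
    mul_inv_cancel₀ hw.ne', ENNReal.ofReal_one, one_mul]

/-- Scaling: under $s=u-(v-u)r$ the product of kernels lives on $r>0$ and equals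
$(v-u)^{2H-3}(r(1+r))^{H-3/2}$. The Jacobian supplies the remaining power of $v-u$. As an identity
in `ℝ≥0∞` it needs no convergence. -/
lemma lintegral_fracKernel_mul_of_lt (H : ℝ) {u v : ℝ} (huv : u < v) :
    ∫⁻ s, ENNReal.ofReal (fracKernel H u s) * ENNReal.ofReal (fracKernel H v s) =
      kernelConst H * ENNReal.ofReal (|u - v| ^ (2 * H - 2)) := by
  have hm : Measurable fun s => ENNReal.ofReal (fracKernel H u s) *
      ENNReal.ofReal (fracKernel H v s) := by
    have h1 : ∀ w, Measurable fun s => fracKernel H w s := fun w =>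
      (measurable_fracKernel H).comp (measurable_const.prodMk measurable_id)
    exact (h1 u).ennreal_ofReal.mul (h1 v).ennreal_ofReal
  have hw : 0 < v - u := sub_pos.2 huv
  rw [← lintegral_sub_left_eq_self _ u,
    lintegral_comp_mul_left_real
      (fun s => ENNReal.ofReal (fracKernel H u (u - s)) * ENNReal.ofReal (fracKernel H v (u - s)))
      (hm.comp (measurable_const.sub measurable_id)) hw]
  have key : ∀ r : ℝ, ENNReal.ofReal (fracKernel H u (u - (v - u) * r)) *
      ENNReal.ofReal (fracKernel H v (u - (v - u) * r)) =
      (Set.Ioi (0 : ℝ)).indicator (fun r => ENNReal.ofReal ((v - u) ^ (2 * H - 3)) *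
        ENNReal.ofReal ((r * (1 + r)) ^ (H - 3 / 2))) r := by
    intro r
    by_cases hr : 0 < r
    · rw [Set.indicator_of_mem (Set.mem_Ioi.2 hr)]
      have h0 : 0 < (v - u) * r := mul_pos hw hr
      have e1 : fracKernel H u (u - (v - u) * r) = ((v - u) * r) ^ (H - 3 / 2) := by
        rw [fracKernel, if_pos (by linarith)]; congr 1; ring
      have e2 : fracKernel H v (u - (v - u) * r) = ((v - u) * (1 + r)) ^ (H - 3 / 2) := by
        rw [fracKernel, if_pos (by linarith)]; congr 1; ring
      rw [e1, e2, ← ENNReal.ofReal_mul (by positivity), ← ENNReal.ofReal_mul (by positivity)]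
      congr 1
      rw [Real.mul_rpow hw.le hr.le, Real.mul_rpow hw.le (by positivity),
        Real.mul_rpow hr.le (by positivity),
        show 2 * H - 3 = (H - 3 / 2) + (H - 3 / 2) by ring, Real.rpow_add hw]
      ring
    · rw [Set.indicator_of_notMem (by simpa using hr), fracKernel, if_neg]
      · simp
      · have : (v - u) * r ≤ 0 := mul_nonpos_of_nonneg_of_nonpos hw.le (not_lt.1 hr)
        linarith
  simp only [key]
  rw [lintegral_indicator measurableSet_Ioi, lintegral_const_mul' _ _ ENNReal.ofReal_ne_top,
    ← mul_assoc, ← ENNReal.ofReal_mul hw.le, mul_comm, kernelConst, abs_sub_comm, abs_of_pos hw]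
  congr 2
  rw [show 2 * H - 2 = 1 + (2 * H - 3) by ring, Real.rpow_add hw, Real.rpow_one]

lemma lintegral_fracKernel_mul (H : ℝ) {u v : ℝ} (huv : u ≠ v) :
    ∫⁻ s, ENNReal.ofReal (fracKernel H u s) * ENNReal.ofReal (fracKernel H v s) =
      kernelConst H * ENNReal.ofReal (|u - v| ^ (2 * H - 2)) := by
  rcases lt_or_gt_of_ne huv with h | h
  · exact lintegral_fracKernel_mul_of_lt H h
  · rw [abs_sub_comm, ← lintegral_fracKernel_mul_of_lt H h]
    simp only [mul_comm]

/-- Near $0$ the integrand is at most $r^{H-3/2}$, integrable because $H>1/2$. On $(1,\infty)$ it is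
at most $r^{2H-3}$, integrable because $H<1$. -/
lemma kernelConst_lt_top {H : ℝ} (hH : 1 / 2 < H) (hH1 : H < 1) : kernelConst H < ∞ := by
  rw [kernelConst, ← Set.Ioc_union_Ioi_eq_Ioi (zero_le_one' ℝ)]
  refine (lintegral_union_le _ _ _).trans_lt (ENNReal.add_lt_top.2 ⟨?_, ?_⟩)
  · have h1 : IntegrableOn (fun r : ℝ => r ^ (H - 3 / 2)) (Set.Ioc 0 1) :=
      (intervalIntegrable_iff_integrableOn_Ioc_of_le zero_le_one).1
        (intervalIntegral.intervalIntegrable_rpow' (by linarith))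
    refine (setLIntegral_mono' measurableSet_Ioc fun r hr => ?_).trans_lt h1.lintegral_lt_top
    refine ENNReal.ofReal_le_ofReal ?_
    rw [Real.mul_rpow hr.1.le (by linarith [hr.1])]
    exact mul_le_of_le_one_right (Real.rpow_nonneg hr.1.le _)
      (Real.rpow_le_one_of_one_le_of_nonpos (by linarith [hr.1]) (by linarith))
  · have h1 : IntegrableOn (fun r : ℝ => r ^ (2 * H - 3)) (Set.Ioi 1) :=
      integrableOn_Ioi_rpow_of_lt (by linarith) one_pos
    refine (setLIntegral_mono' measurableSet_Ioi fun r hr => ?_).trans_lt h1.lintegral_lt_top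
    have hr1 : 1 < r := hr
    refine ENNReal.ofReal_le_ofReal ?_
    rw [Real.mul_rpow (by linarith) (by linarith),
      show 2 * H - 3 = (H - 3 / 2) + (H - 3 / 2) by ring, Real.rpow_add (by linarith)]
    exact mul_le_mul_of_nonneg_left
      (Real.rpow_le_rpow_of_nonpos (by linarith) (by linarith) (by linarith))
      (Real.rpow_nonneg (by linarith) _)

lemma kernelConst_ne_zero (H : ℝ) : kernelConst H ≠ 0 := by
  unfold kernelConst
  have hm : Measurable fun r : ℝ => ENNReal.ofReal ((r * (1 + r)) ^ (H - 3 / 2)) := by fun_prop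
  refine ((setLIntegral_pos_iff hm).2 ?_).ne'
  have : Set.Ioi (0 : ℝ) ⊆ (Function.support fun r : ℝ =>
      ENNReal.ofReal ((r * (1 + r)) ^ (H - 3 / 2))) ∩ Set.Ioi 0 := by
    intro r hr
    have hr' : 0 < r := hr
    refine ⟨?_, hr⟩
    rw [Function.mem_support]
    exact (ENNReal.ofReal_pos.2 (by positivity)).ne'
  refine lt_of_lt_of_le ?_ (measure_mono this)
  simp

lemma kernelConst_toReal_pos {H : ℝ} (hH : 1 / 2 < H) (hH1 : H < 1) :
    0 < (kernelConst H).toReal :=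
  ENNReal.toReal_pos (kernelConst_ne_zero H) (kernelConst_lt_top hH hH1).ne

/-! ### Integrals over time intervals -/

lemma integrableOn_fracKernel {H : ℝ} (hH : 1 / 2 < H) (s l r : ℝ) :
    IntegrableOn (fun u => fracKernel H u s) (Set.Ioc l r) := by
  have h1 : IntervalIntegrable (fun x : ℝ => x ^ (H - 3 / 2)) volume (0 : ℝ) (max (r - s) 0) :=
    intervalIntegral.intervalIntegrable_rpow' (by linarith)
  have h2 := (h1.comp_sub_right s)
  rw [intervalIntegrable_iff_integrableOn_Ioc_of_le (by simp)] at h2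
  have h3 : IntegrableOn (fun u => fracKernel H u s) (Set.Ioc (0 + s) (max (r - s) 0 + s)) := by
    refine h2.congr_fun (fun u hu => ?_) measurableSet_Ioc
    simp only [fracKernel]
    rw [if_pos (by linarith [hu.1])]
  have h4 : IntegrableOn (fun u => fracKernel H u s) (Set.Iic s) :=
    (integrableOn_zero (μ := volume) (s := Set.Iic s)).congr_fun (fun u hu => by
      simp only [fracKernel]
      rw [if_neg (not_lt.2 hu)]) measurableSet_Iic
  refine (h4.union h3).mono_set fun u hu => ?_
  by_cases h : u ≤ s
  · exact Or.inl h
  · refine Or.inr ⟨by linarith, ?_⟩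
    have := le_max_left (r - s) 0
    linarith [hu.2]

/-- The integral of the time kernel over `(l, r]`. -/
def kernelInt (H l r s : ℝ) : ℝ := ∫ u in Set.Ioc l r, fracKernel H u s

lemma kernelInt_nonneg (H l r s : ℝ) : 0 ≤ kernelInt H l r s :=
  integral_nonneg fun _ => fracKernel_nonneg _ _ _

lemma measurable_kernelInt (H l r : ℝ) : Measurable (kernelInt H l r) := by
  have : StronglyMeasurable fun s => ∫ u in Set.Ioc l r, fracKernel H u s :=
    StronglyMeasurable.integral_prod_right (f := fun s u => fracKernel H u s)
      ((measurable_fracKernel H).comp measurable_swap).stronglyMeasurable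
  exact this.measurable

lemma ofReal_kernelInt {H : ℝ} (hH : 1 / 2 < H) (l r s : ℝ) :
    ENNReal.ofReal (kernelInt H l r s) =
      ∫⁻ u in Set.Ioc l r, ENNReal.ofReal (fracKernel H u s) :=
  ofReal_integral_eq_lintegral_ofReal (integrableOn_fracKernel hH s l r)
    (ae_of_all _ fun _ => fracKernel_nonneg _ _ _)

/-- The signed power is the primitive of $p|x|^{p-1}$. In the application $p=2H-1<1$, so that
derivative is singular at $0$; continuity there suffices for the fundamental theorem of calculus off
a countable set. -/
lemma continuous_signed_rpow {p : ℝ} (hp : 0 < p) : Continuous fun x : ℝ => |x| ^ (p - 1) * x := by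
  rw [continuous_iff_continuousAt]
  intro x
  by_cases hx : x = 0
  · subst hx
    rw [ContinuousAt, mul_zero]
    refine squeeze_zero_norm (a := fun x : ℝ => |x| ^ p) (fun y => ?_) ?_
    · by_cases hy : y = 0
      · simp [hy, Real.zero_rpow hp.ne']
      · rw [norm_mul, Real.norm_eq_abs, Real.norm_eq_abs,
          abs_of_nonneg (Real.rpow_nonneg (abs_nonneg y) _)]
        nth_rw 2 [← Real.rpow_one |y|]
        rw [← Real.rpow_add (abs_pos.2 hy)]
        simp
    · have : Continuous fun x : ℝ => |x| ^ p := continuous_abs.rpow_const fun _ => Or.inr hp.le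
      simpa [Real.zero_rpow hp.ne'] using this.tendsto 0
  · exact (continuous_abs.continuousAt.rpow_const (Or.inl (abs_ne_zero.2 hx))).mul continuousAt_id

lemma hasDerivAt_signed_rpow {p x : ℝ} (hx : x ≠ 0) :
    HasDerivAt (fun x : ℝ => |x| ^ (p - 1) * x) (p * |x| ^ (p - 1)) x := by
  have h := ((hasDerivAt_abs hx).rpow_const (p := p - 1) (Or.inl (abs_ne_zero.2 hx))).mul
    (hasDerivAt_id x)
  refine h.congr_deriv ?_
  have hs : ((SignType.sign x : SignType) : ℝ) * x = |x| := by
    rcases lt_or_gt_of_ne hx with h | h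
    · simp [h, abs_of_neg h]
    · simp [h, abs_of_pos h]
  have h2 : |x| ^ (p - 1 - 1) * |x| = |x| ^ (p - 1) := by
    nth_rw 2 [← Real.rpow_one |x|]
    rw [← Real.rpow_add (abs_pos.2 hx)]; congr 1; ring
  simp only [id]
  rw [← h2]
  linear_combination (p - 1) * |x| ^ (p - 1 - 1) * hs

lemma intervalIntegrable_abs_rpow {q : ℝ} (hq : -1 < q) (l r : ℝ) :
    IntervalIntegrable (fun x : ℝ => |x| ^ q) volume l r := by
  have h0 : ∀ r : ℝ, 0 ≤ r → IntervalIntegrable (fun x : ℝ => |x| ^ q) volume 0 r := by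
    intro r hr
    refine (intervalIntegral.intervalIntegrable_rpow' (a := 0) (b := r) hq).congr ?_
    intro x hx
    rw [Set.uIoc_of_le hr] at hx
    simp [abs_of_pos hx.1]
  have h1 : ∀ r : ℝ, IntervalIntegrable (fun x : ℝ => |x| ^ q) volume 0 r := by
    intro r
    rcases le_total 0 r with hr | hr
    · exact h0 r hr
    · have h := (IntervalIntegrable.iff_comp_neg (by simp)).1 (h0 (-r) (by linarith))
      simpa using h
  exact (h1 l).symm.trans (h1 r)

lemma integral_abs_sub_rpow {p : ℝ} (hp : 0 < p) (u l r : ℝ) :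
    p * ∫ v in l..r, |u - v| ^ (p - 1) =
      |u - l| ^ (p - 1) * (u - l) - |u - r| ^ (p - 1) * (u - r) := by
  rw [intervalIntegral.integral_comp_sub_left (fun x => |x| ^ (p - 1)),
    ← intervalIntegral.integral_const_mul]
  exact integral_eq_of_hasDerivAt_off_countable (fun x : ℝ => |x| ^ (p - 1) * x) _
    (Set.countable_singleton 0) (continuous_signed_rpow hp).continuousOn
    (fun x hx => hasDerivAt_signed_rpow hx.2)
    ((intervalIntegrable_abs_rpow (by linarith) _ _).const_mul _)

/-- Integrating twice turns $|x|^{2H-2}$ first into the signed power and then into $|x|^{2H}$. In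
the rectangular increment of `fbmCov` the terms in a single time cancel, leaving exactly these
differences. -/
lemma integral_integral_abs_sub_rpow {H : ℝ} (hH : 1 / 2 < H) {s t s' t' : ℝ}
    (hst : s ≤ t) (hst' : s' ≤ t') :
    H * (2 * H - 1) * ∫ u in Set.Ioc s t, ∫ v in Set.Ioc s' t', |u - v| ^ (2 * H - 2) =
      fbmCov H t t' - fbmCov H t s' - fbmCov H s t' + fbmCov H s s' := by
  rw [← intervalIntegral.integral_of_le hst]
  simp_rw [← intervalIntegral.integral_of_le hst']
  have h1 : ∀ u, (2 * H - 1) * ∫ v in s'..t', |u - v| ^ (2 * H - 2) =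
      |u - s'| ^ (2 * H - 2) * (u - s') - |u - t'| ^ (2 * H - 2) * (u - t') := by
    intro u
    have := integral_abs_sub_rpow (p := 2 * H - 1) (by linarith) u s' t'
    rwa [show 2 * H - 1 - 1 = 2 * H - 2 by ring] at this
  have hc : Continuous fun x : ℝ => |x| ^ (2 * H - 2) * x := by
    have := continuous_signed_rpow (p := 2 * H - 1) (by linarith)
    rwa [show 2 * H - 1 - 1 = 2 * H - 2 by ring] at this
  have h2 : ∀ c : ℝ, 2 * H * ∫ u in s..t, |u - c| ^ (2 * H - 2) * (u - c) =
      |t - c| ^ (2 * H) - |s - c| ^ (2 * H) := by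
    intro c
    rw [intervalIntegral.integral_comp_sub_right (fun x => |x| ^ (2 * H - 2) * x),
      ← intervalIntegral.integral_const_mul]
    refine intervalIntegral.integral_eq_sub_of_hasDerivAt (f := fun x : ℝ => |x| ^ (2 * H))
      (fun x _ => ?_) ((continuous_const.mul hc).intervalIntegrable _ _)
    have := hasDerivAt_abs_rpow x (p := 2 * H) (by linarith)
    rwa [mul_assoc] at this
  have h3 : (2 * H - 1) * ∫ u in s..t, ∫ v in s'..t', |u - v| ^ (2 * H - 2) =
      (∫ u in s..t, |u - s'| ^ (2 * H - 2) * (u - s')) -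
        ∫ u in s..t, |u - t'| ^ (2 * H - 2) * (u - t') := by
    rw [← intervalIntegral.integral_const_mul, ← intervalIntegral.integral_sub]
    · simp_rw [h1]
    · exact (hc.comp (continuous_id.sub continuous_const)).intervalIntegrable _ _
    · exact (hc.comp (continuous_id.sub continuous_const)).intervalIntegrable _ _
  rw [mul_assoc, h3]
  have a := h2 s'
  have b := h2 t'
  unfold fbmCov
  linear_combination (1 / 2 : ℝ) * a - (1 / 2 : ℝ) * b

/-- Certifies that the iterated Bochner integral is a genuine one: the inner integral is an explicit
continuous function of $u$, hence integrable over a bounded interval. -/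
lemma lintegral_lintegral_abs_sub_rpow {H : ℝ} (hH : 1 / 2 < H) {s t s' t' : ℝ}
    (hst' : s' ≤ t') :
    ∫⁻ u in Set.Ioc s t, ∫⁻ v in Set.Ioc s' t', ENNReal.ofReal (|u - v| ^ (2 * H - 2)) =
      ENNReal.ofReal (∫ u in Set.Ioc s t, ∫ v in Set.Ioc s' t', |u - v| ^ (2 * H - 2)) := by
  have hint : ∀ u : ℝ, IntegrableOn (fun v => |u - v| ^ (2 * H - 2)) (Set.Ioc s' t') := by
    intro u
    have h := (intervalIntegrable_abs_rpow (q := 2 * H - 2) (by linarith)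
      (s' - u) (t' - u)).comp_sub_right u
    rw [intervalIntegrable_iff_integrableOn_Ioc_of_le (by linarith)] at h
    simpa [abs_sub_comm] using h
  have hc : Continuous fun x : ℝ => |x| ^ (2 * H - 2) * x := by
    have := continuous_signed_rpow (p := 2 * H - 1) (by linarith)
    rwa [show 2 * H - 1 - 1 = 2 * H - 2 by ring] at this
  have h1 : ∀ u, ∫ v in Set.Ioc s' t', |u - v| ^ (2 * H - 2) = (2 * H - 1)⁻¹ *
      (|u - s'| ^ (2 * H - 2) * (u - s') - |u - t'| ^ (2 * H - 2) * (u - t')) := by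
    intro u
    have := integral_abs_sub_rpow (p := 2 * H - 1) (by linarith) u s' t'
    rw [show 2 * H - 1 - 1 = 2 * H - 2 by ring, intervalIntegral.integral_of_le hst'] at this
    rw [← this, inv_mul_cancel_left₀ (by linarith)]
  rw [ofReal_integral_eq_lintegral_ofReal]
  · refine lintegral_congr fun u => ?_
    rw [ofReal_integral_eq_lintegral_ofReal (hint u)]
    exact ae_of_all _ fun v => Real.rpow_nonneg (abs_nonneg _) _
  · simp_rw [h1]
    refine (Continuous.integrableOn_Icc ?_).mono_set Set.Ioc_subset_Icc_self
    exact continuous_const.mul ((hc.comp (continuous_id.sub continuous_const)).sub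
      (hc.comp (continuous_id.sub continuous_const)))
  · exact ae_of_all _ fun u => integral_nonneg fun v => Real.rpow_nonneg (abs_nonneg _) _

lemma lintegral_kernelInt_mul {H : ℝ} (hH : 1 / 2 < H) {s t s' t' : ℝ} (hst' : s' ≤ t') :
    ∫⁻ w, ENNReal.ofReal (kernelInt H s t w) * ENNReal.ofReal (kernelInt H s' t' w) =
      kernelConst H * ENNReal.ofReal
        (∫ u in Set.Ioc s t, ∫ v in Set.Ioc s' t', |u - v| ^ (2 * H - 2)) := by
  have hk := (measurable_fracKernel H).ennreal_ofReal
  have hk1 : ∀ w, Measurable fun u => ENNReal.ofReal (fracKernel H u w) := fun w =>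
    (measurable_fracKernel_left H w).ennreal_ofReal
  have hk3 : Measurable fun p : (ℝ × ℝ) × ℝ =>
      ENNReal.ofReal (fracKernel H p.2 p.1.2) * ENNReal.ofReal (fracKernel H p.1.1 p.1.2) :=
    (hk.comp (measurable_snd.prodMk (measurable_snd.comp measurable_fst))).mul
      (hk.comp measurable_fst)
  calc ∫⁻ w, ENNReal.ofReal (kernelInt H s t w) * ENNReal.ofReal (kernelInt H s' t' w)
      = ∫⁻ w, ∫⁻ u in Set.Ioc s t, ∫⁻ v in Set.Ioc s' t',
          ENNReal.ofReal (fracKernel H v w) * ENNReal.ofReal (fracKernel H u w) := by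
        refine lintegral_congr fun w => ?_
        rw [ofReal_kernelInt hH, ofReal_kernelInt hH, ← lintegral_mul_const _ (hk1 w)]
        refine lintegral_congr fun u => ?_
        rw [lintegral_mul_const _ (hk1 w), mul_comm]
    _ = ∫⁻ u in Set.Ioc s t, ∫⁻ w, ∫⁻ v in Set.Ioc s' t',
          ENNReal.ofReal (fracKernel H v w) * ENNReal.ofReal (fracKernel H u w) := by
        refine lintegral_lintegral_swap (Measurable.aemeasurable ?_)
        exact Measurable.lintegral_prod_right'
          (f := fun p : (ℝ × ℝ) × ℝ => ENNReal.ofReal (fracKernel H p.2 p.1.1) *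
            ENNReal.ofReal (fracKernel H p.1.2 p.1.1))
          (hk3.comp ((measurable_swap.comp measurable_fst).prodMk measurable_snd))
    _ = ∫⁻ u in Set.Ioc s t, ∫⁻ v in Set.Ioc s' t', ∫⁻ w,
          ENNReal.ofReal (fracKernel H v w) * ENNReal.ofReal (fracKernel H u w) := by
        refine lintegral_congr fun u => lintegral_lintegral_swap (Measurable.aemeasurable ?_)
        exact (hk.comp measurable_swap).mul
          (hk.comp (measurable_const.prodMk measurable_fst))
    _ = ∫⁻ u in Set.Ioc s t, ∫⁻ v in Set.Ioc s' t',
          kernelConst H * ENNReal.ofReal (|u - v| ^ (2 * H - 2)) := by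
        refine lintegral_congr fun u => lintegral_congr_ae (ae_restrict_of_ae ?_)
        filter_upwards [volume.ae_ne u] with v hv
        rw [lintegral_fracKernel_mul H hv, abs_sub_comm]
    _ = _ := by
        rw [← lintegral_lintegral_abs_sub_rpow hH hst', ← lintegral_const_mul]
        · refine lintegral_congr fun u => ?_
          rw [lintegral_const_mul]
          fun_prop
        · exact Measurable.lintegral_prod_right'
            (f := fun p : ℝ × ℝ => ENNReal.ofReal (|p.1 - p.2| ^ (2 * H - 2))) (by fun_prop)

lemma memLp_kernelInt {H : ℝ} (hH : 1 / 2 < H) (hH1 : H < 1) {s t : ℝ} (hst : s ≤ t) :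
    MemLp (kernelInt H s t) 2 := by
  rw [memLp_two_iff_integrable_sq (measurable_kernelInt H s t).aestronglyMeasurable]
  refine ⟨((measurable_kernelInt H s t).pow_const 2).aestronglyMeasurable, ?_⟩
  rw [hasFiniteIntegral_iff_ofReal (ae_of_all _ fun _ => sq_nonneg _)]
  have h := lintegral_kernelInt_mul hH (s := s) (t := t) hst
  simp_rw [← ENNReal.ofReal_mul (kernelInt_nonneg H s t _), ← sq] at h
  rw [h]
  exact ENNReal.mul_lt_top (kernelConst_lt_top hH hH1) ENNReal.ofReal_lt_top

lemma integral_kernelInt_mul {H : ℝ} (hH : 1 / 2 < H) {s t s' t' : ℝ}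
    (hst : s ≤ t) (hst' : s' ≤ t') :
    H * (2 * H - 1) * ∫ w, kernelInt H s t w * kernelInt H s' t' w =
      (kernelConst H).toReal *
        (fbmCov H t t' - fbmCov H t s' - fbmCov H s t' + fbmCov H s s') := by
  rw [← integral_integral_abs_sub_rpow hH hst hst', integral_eq_lintegral_of_nonneg_ae
    (ae_of_all _ fun w => mul_nonneg (kernelInt_nonneg _ _ _ _) (kernelInt_nonneg _ _ _ _))
    ((measurable_kernelInt H s t).mul (measurable_kernelInt H s' t')).aestronglyMeasurable]
  simp_rw [ENNReal.ofReal_mul (kernelInt_nonneg H s t _)]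
  rw [lintegral_kernelInt_mul hH hst', ENNReal.toReal_mul, ENNReal.toReal_ofReal]
  · ring
  · exact integral_nonneg fun u => integral_nonneg fun v => Real.rpow_nonneg (abs_nonneg _) _

/-! ### The Fourier transform without $2\pi$ -/

lemma norm_exp_neg_I_mul (r : ℝ) : ‖Complex.exp (-(Complex.I * (r : ℂ)))‖ = 1 := by
  rw [← mul_neg, ← Complex.ofReal_neg, mul_comm, Complex.norm_exp_ofReal_mul_I]

lemma fourier_eq_fourier {d : ℕ} (g : Space d → ℂ) (ξ : Space d) :
    fourier g ξ = FourierTransform.fourier g ((2 * Real.pi)⁻¹ • ξ) := by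
  rw [Real.fourier_eq', fourier]
  refine integral_congr_ae (ae_of_all _ fun v => ?_)
  simp only [smul_eq_mul]
  congr 2
  rw [inner_smul_right, real_inner_comm]
  push_cast
  have : (Real.pi : ℂ) ≠ 0 := by exact_mod_cast Real.pi_ne_zero
  field_simp

lemma norm_fourier_le {d : ℕ} (g : Space d → ℂ) (ξ : Space d) : ‖fourier g ξ‖ ≤ ∫ x, ‖g x‖ := by
  refine (norm_integral_le_integral_norm _).trans_eq ?_
  simp [norm_exp_neg_I_mul]

/-! ### Tempered measures -/

lemma IsTempered.hasTemperateGrowth {d : ℕ} {μ : Measure (Space d)} (hμ : IsTempered μ) :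
    μ.HasTemperateGrowth := by
  obtain ⟨l, hl, hfin⟩ := hμ
  have hint : Integrable (fun ξ : Space d => (1 / (1 + ‖ξ‖ ^ 2)) ^ l) μ := by
    refine ⟨(Measurable.pow_const (by fun_prop) _).aestronglyMeasurable, ?_⟩
    rwa [hasFiniteIntegral_iff_ofReal (ae_of_all _ fun ξ => by positivity)]
  refine ⟨⌈2 * l⌉₊, hint.mono (Measurable.pow_const (by fun_prop) _).aestronglyMeasurable
    (ae_of_all _ fun ξ => ?_)⟩
  have h1 : (0 : ℝ) < 1 + ‖ξ‖ := by positivity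
  have h2 : (0 : ℝ) < 1 + ‖ξ‖ ^ 2 := by positivity
  rw [Real.norm_of_nonneg (by positivity), Real.norm_of_nonneg (by positivity)]
  calc (1 + ‖ξ‖) ^ (-(⌈2 * l⌉₊ : ℝ)) ≤ (1 + ‖ξ‖) ^ (-(2 * l)) :=
        Real.rpow_le_rpow_of_exponent_le (by linarith [norm_nonneg ξ])
          (neg_le_neg (Nat.le_ceil _))
    _ = ((1 + ‖ξ‖) ^ 2) ^ (-l) := by
        rw [← Real.rpow_natCast, ← Real.rpow_mul h1.le]; congr 1; push_cast; ring
    _ ≤ (1 + ‖ξ‖ ^ 2) ^ (-l) :=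
        Real.rpow_le_rpow_of_nonpos h2 (by nlinarith [norm_nonneg ξ]) (by linarith)
    _ = (1 / (1 + ‖ξ‖ ^ 2)) ^ l := by
        rw [one_div, Real.inv_rpow h2.le, Real.rpow_neg h2.le]

/-- The temperedness weight is a positive finite density that makes `μ` a finite measure; dividing
the density out again preserves σ-finiteness. -/
lemma IsTempered.sigmaFinite {d : ℕ} {μ : Measure (Space d)} (hμ : IsTempered μ) :
    SigmaFinite μ := by
  obtain ⟨l, hl, hfin⟩ := hμ
  have hpos : ∀ ξ : Space d, 0 < (1 / (1 + ‖ξ‖ ^ 2)) ^ l := fun ξ => by positivity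
  have hm : Measurable fun ξ : Space d => ENNReal.ofReal ((1 / (1 + ‖ξ‖ ^ 2)) ^ l) :=
    (Measurable.pow_const (by fun_prop) _).ennreal_ofReal
  have : IsFiniteMeasure (μ.withDensity fun ξ => ENNReal.ofReal ((1 / (1 + ‖ξ‖ ^ 2)) ^ l)) :=
    isFiniteMeasure_withDensity hfin.ne
  rw [← withDensity_inv_same (μ := μ) hm (ae_of_all _ fun ξ => (ENNReal.ofReal_pos.2 (hpos ξ)).ne')
    (ae_of_all _ fun ξ => ENNReal.ofReal_ne_top)]
  refine SigmaFinite.withDensity_of_ne_top (ae_of_all _ fun ξ => ?_)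
  exact ENNReal.inv_ne_top.2 (ENNReal.ofReal_pos.2 (hpos ξ)).ne'

lemma integrable_fourier_schwartz {d : ℕ} {μ : Measure (Space d)} [μ.HasTemperateGrowth]
    (φ : 𝓢(Space d, ℂ)) : Integrable (fourier fun x => φ x) μ := by
  have h2 : (2 * Real.pi)⁻¹ ≠ 0 := inv_ne_zero (by positivity)
  let e : Space d ≃L[ℝ] Space d :=
    ContinuousLinearEquiv.smulLeft (M₁ := Space d) (Units.mk0 (2 * Real.pi)⁻¹ h2)
  have h := (SchwartzMap.compCLMOfContinuousLinearEquiv ℂ e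
    (FourierTransform.fourier φ)).integrable (μ := μ)
  refine h.congr (ae_of_all _ fun ξ => ?_)
  simp only [SchwartzMap.compCLMOfContinuousLinearEquiv_apply, Function.comp_apply,
    SchwartzMap.fourier_coe]
  rw [fourier_eq_fourier]
  rfl

/-! ### Mollifiers with non-negative Fourier transform -/

/-- The integral is the convolution of `φ n` with the reflection of `g`, evaluated at $0$. -/
lemma tendsto_integral_mul_of_support {d : ℕ} {φ : ℕ → Space d → ℝ} (h0 : ∀ n x, 0 ≤ φ n x)
    (h1 : ∀ n, ∫ x, φ n x = 1)
    (hs : Tendsto (fun n => Function.support (φ n)) atTop (𝓝 0).smallSets)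
    {E : Type*} [NormedAddCommGroup E] [NormedSpace ℝ E] [CompleteSpace E] {g : Space d → E}
    (hg : AEStronglyMeasurable g) (hc : ContinuousAt g 0) :
    Tendsto (fun n => ∫ x, φ n x • g x) atTop (𝓝 (g 0)) := by
  have hg' : AEStronglyMeasurable (fun x => g (-x)) :=
    hg.comp_quasiMeasurePreserving (Measure.measurePreserving_neg _).quasiMeasurePreserving
  have hc' : Tendsto (fun x => g (-x)) (𝓝 0) (𝓝 (g 0)) := by
    have : Tendsto (fun x : Space d => -x) (𝓝 0) (𝓝 0) := by
      simpa using (continuous_neg (G := Space d)).tendsto 0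
    exact hc.tendsto.comp this
  have := convolution_tendsto_right (μ := volume) (l := atTop) (φ := φ)
    (g := fun _ : ℕ => fun x => g (-x)) (k := fun _ => 0) (x₀ := 0) (z₀ := g 0)
    (Eventually.of_forall h0) (Eventually.of_forall h1) hs (Eventually.of_forall fun _ => hg')
    (hc'.comp tendsto_snd) tendsto_const_nhds
  simpa [convolution] using this

/-- The multipliers `r n` lie in $[0,1]$ and tend to $1$. Non-negativity is what Fatou's lemma needs
in `memLp_indFourier`; the upper bound gives the domination in `integral_indFourier_mul_conj`. The
common ball of radius 2 localizes all tests against `f`. -/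
structure IsMollifier {d : ℕ} (φ r : ℕ → Space d → ℝ) : Prop where
  contDiff : ∀ n, ContDiff ℝ (⊤ : ℕ∞) (φ n)
  compact : ∀ n, HasCompactSupport (φ n)
  nonneg : ∀ n x, 0 ≤ φ n x
  integral : ∀ n, ∫ x, φ n x = 1
  support : Tendsto (fun n => Function.support (φ n)) atTop (𝓝 0).smallSets
  support_subset : ∀ n, Function.support (φ n) ⊆ Metric.ball 0 2
  fourier : ∀ n ξ, fourier (fun x => (φ n x : ℂ)) ξ = r n ξ
  fourier_nonneg : ∀ n ξ, 0 ≤ r n ξ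
  fourier_le : ∀ n ξ, r n ξ ≤ 1
  tendsto : ∀ ξ, Tendsto (fun n => r n ξ) atTop (𝓝 1)

/-- Convolve a normalized bump with itself. The bump is even, so its transform $R$ is real, and the
convolution has transform $R^2\ge 0$. -/
lemma exists_mollifier (d : ℕ) : ∃ φ r : ℕ → Space d → ℝ, IsMollifier φ r := by
  let β : ℕ → ContDiffBump (0 : Space d) := fun n =>
    ⟨1 / (2 * ((n : ℝ) + 1)), 1 / ((n : ℝ) + 1), by positivity, by
      apply one_div_lt_one_div_of_lt <;> linarith [Nat.cast_nonneg (α := ℝ) n]⟩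
  have hrout : ∀ n, (β n).rOut = 1 / ((n : ℝ) + 1) := fun n => rfl
  let ψ : ℕ → Space d → ℝ := fun n => (β n).normed volume
  let L := ContinuousLinearMap.mul ℝ ℝ
  let φ : ℕ → Space d → ℝ := fun n => convolution (ψ n) (ψ n) L volume
  let R : ℕ → Space d → ℂ := fun n ξ => fourier (fun x => (ψ n x : ℂ)) ξ
  have hψi : ∀ n, Integrable (ψ n) := fun n => (β n).integrable_normed
  have hψ0 : ∀ n x, 0 ≤ ψ n x := fun n x => (β n).nonneg_normed x
  have hφ0 : ∀ n x, 0 ≤ φ n x := fun n x => integral_nonneg fun t => mul_nonneg (hψ0 n _) (hψ0 n _)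
  have hφ1 : ∀ n, ∫ x, φ n x = 1 := by
    intro n
    rw [integral_convolution L (hψi n) (hψi n)]
    simp [L, ψ, ContDiffBump.integral_normed]
  have hφc : ∀ n, HasCompactSupport (φ n) := fun n =>
    HasCompactSupport.convolution L (β n).hasCompactSupport_normed (β n).hasCompactSupport_normed
  have hφs : ∀ n, ContDiff ℝ (⊤ : ℕ∞) (φ n) := fun n =>
    HasCompactSupport.contDiff_convolution_right L (β n).hasCompactSupport_normed
      (hψi n).locallyIntegrable (β n).contDiff_normed
  have hsupp : ∀ n, Function.support (φ n) ⊆ Metric.ball 0 (2 * (1 / ((n : ℝ) + 1))) := by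
    intro n x hx
    obtain ⟨y, hy, z, hz, rfl⟩ := Set.mem_add.1 (support_convolution_subset L hx)
    rw [ContDiffBump.support_normed_eq, hrout] at hy hz
    rw [mem_ball_zero_iff] at *
    linarith [norm_add_le y z]
  have hsm : Tendsto (fun n => Function.support (φ n)) atTop (𝓝 0).smallSets := by
    rw [tendsto_smallSets_iff]
    intro t ht
    obtain ⟨ε, hε, hb⟩ := Metric.mem_nhds_iff.1 ht
    have h := (tendsto_one_div_add_atTop_nhds_zero_nat (𝕜 := ℝ)).const_mul 2
    rw [mul_zero] at h
    filter_upwards [h.eventually (gt_mem_nhds hε)] with n hn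
    exact ((hsupp n).trans (Metric.ball_subset_ball hn.le)).trans hb
  have hψC : ∀ n, Integrable (fun x => (ψ n x : ℂ)) := fun n => (hψi n).ofReal
  have hR : ∀ n ξ, fourier (fun x => (φ n x : ℂ)) ξ = R n ξ * R n ξ := by
    intro n ξ
    have hconv : (fun x => (φ n x : ℂ)) = convolution (fun x => (ψ n x : ℂ))
        (fun x => (ψ n x : ℂ)) (ContinuousLinearMap.mul ℂ ℂ) volume := by
      ext x
      simp only [φ, convolution, L, ContinuousLinearMap.mul_apply']
      rw [← integral_complex_ofReal]
      simp
    simp only [R, fourier_eq_fourier, hconv]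
    exact Real.fourier_mul_convolution_eq (hψC n) (hψC n) _
  have hRc : ∀ n ξ, (starRingEnd ℂ) (R n ξ) = R n ξ := by
    intro n ξ
    simp only [R, fourier]
    rw [← integral_conj, ← integral_neg_eq_self]
    refine integral_congr_ae (ae_of_all _ fun x => ?_)
    have : ψ n (-x) = ψ n x := (β n).normed_neg x
    simp [← Complex.exp_conj, this]
  refine ⟨φ, fun n ξ => ‖R n ξ‖ ^ 2, hφs, hφc, hφ0, hφ1, hsm, fun n => ?_, fun n ξ => ?_,
    fun n ξ => by positivity, fun n ξ => ?_, fun ξ => ?_⟩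
  · refine (hsupp n).trans (Metric.ball_subset_ball ?_)
    have : 1 / ((n : ℝ) + 1) ≤ 1 := by
      rw [div_le_one (by positivity)]; linarith [Nat.cast_nonneg (α := ℝ) n]
    linarith
  · rw [hR, ← Complex.normSq_eq_norm_sq, ← Complex.mul_conj, hRc]
  · have h := norm_fourier_le (fun x => (ψ n x : ℂ)) ξ
    have : ∫ x, ‖(ψ n x : ℂ)‖ = 1 := by
      simp_rw [Complex.norm_real, Real.norm_of_nonneg (hψ0 n _)]
      exact (β n).integral_normed
    rw [this] at h
    exact pow_le_one₀ (norm_nonneg _) h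
  · have hcont : Continuous fun x : Space d =>
        Complex.exp (-(Complex.I * ((inner ℝ ξ x : ℝ) : ℂ))) := by fun_prop
    have h := tendsto_integral_mul_of_support hφ0 hφ1 hsm hcont.aestronglyMeasurable
      hcont.continuousAt
    have h2 : ∀ n, ∫ x, φ n x • Complex.exp (-(Complex.I * ((inner ℝ ξ x : ℝ) : ℂ))) =
        ((‖R n ξ‖ ^ 2 : ℝ) : ℂ) := by
      intro n
      rw [← Complex.normSq_eq_norm_sq, ← Complex.mul_conj, hRc, ← hR, fourier]
      refine integral_congr_ae (ae_of_all _ fun x => ?_)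
      simp [mul_comm]
    simp_rw [h2] at h
    have h3 := (Complex.continuous_re.tendsto _).comp h
    simpa [Function.comp_def, ← Complex.ofReal_pow] using h3

lemma tendsto_integral_norm_translate {d : ℕ} {g : Space d → ℝ} (hg : Integrable g) :
    Tendsto (fun y => ∫ w, ‖g (y + w) - g w‖) (𝓝 0) (𝓝 0) := by
  let c : C(Space d, C(Space d, Space d)) := ContinuousMap.curry ⟨fun p => p.1 + p.2, by fun_prop⟩
  have hmp : ∀ y, MeasurePreserving (c y) volume volume := fun y => measurePreserving_add_left _ y
  let G : Lp ℝ 1 (volume : Measure (Space d)) := hg.toL1 g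
  have h := Filter.Tendsto.compMeasurePreservingLp (f := fun _ : Space d => G) (f₀ := G)
    (g := fun y => c y) (g₀ := c 0) tendsto_const_nhds (c.continuous.tendsto 0) hmp (hmp 0)
    ENNReal.one_ne_top
  have h0 : Lp.compMeasurePreserving (c 0) (hmp 0) G = G := by
    apply Lp.ext
    refine (Lp.coeFn_compMeasurePreserving G (hmp 0)).trans (ae_of_all _ fun w => ?_)
    simp [c]
  rw [h0] at h
  have h1 := (tendsto_iff_norm_sub_tendsto_zero).1 h
  refine h1.congr fun y => ?_
  rw [L1.norm_eq_integral_norm]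
  refine integral_congr_ae ?_
  filter_upwards [Lp.coeFn_sub (Lp.compMeasurePreserving (c y) (hmp y) G) G,
    Lp.coeFn_compMeasurePreserving G (hmp y), hg.coeFn_toL1,
    (hmp y).quasiMeasurePreserving.ae hg.coeFn_toL1] with w h2 h3 h4 h5
  rw [h2, Pi.sub_apply, h3, Function.comp_apply, h4, h5]
  rfl

/-- Test `f` against a smooth bump that equals 1 on the ball. -/
lemma IsFourierTransformOf.integrableOn_ball {d : ℕ} {f : Space d → ℝ} {μ : Measure (Space d)}
    (hf : IsFourierTransformOf f μ) {R : ℝ} (hR : 0 < R) : IntegrableOn f (Metric.ball 0 R) := by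
  let b : ContDiffBump (0 : Space d) := ⟨R, R + 1, hR, by linarith⟩
  have hb1 : HasCompactSupport fun x => (b x : ℂ) := b.hasCompactSupport.comp_left Complex.ofReal_zero
  have hb2 : ContDiff ℝ (⊤ : ℕ∞) fun x => (b x : ℂ) := Complex.ofRealCLM.contDiff.comp b.contDiff
  have h := (hf (hb1.toSchwartzMap hb2)).1.re
  have h2 : IntegrableOn (fun x => f x * b x) (Metric.ball 0 R) := by
    refine (h.congr (ae_of_all _ fun x => ?_)).integrableOn
    change Complex.re ((f x : ℂ) * (b x : ℂ)) = _
    rw [← Complex.ofReal_mul, Complex.ofReal_re]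
  refine h2.congr_fun (fun x hx => ?_) measurableSet_ball
  have : b x = 1 := b.one_of_mem_closedBall (Metric.ball_subset_closedBall hx)
  simp [this]

lemma integral_mul_translate_mollifier {d : ℕ} {f : Space d → ℝ} {μ : Measure (Space d)}
    (hf : IsFourierTransformOf f μ) {φ r : ℕ → Space d → ℝ} (hφ : IsMollifier φ r) (n : ℕ)
    (w : Space d) :
    ((∫ x, f x * φ n (x - w) : ℝ) : ℂ) =
      ∫ ξ, Complex.exp (-(Complex.I * ((inner ℝ ξ w : ℝ) : ℂ))) * r n ξ ∂μ := by
  have hb0 : HasCompactSupport fun x => φ n (x - w) := by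
    simpa [Function.comp_def, sub_eq_add_neg] using
      (hφ.compact n).comp_homeomorph (Homeomorph.addRight (-w))
  have hb1 : HasCompactSupport fun x => (φ n (x - w) : ℂ) := hb0.comp_left Complex.ofReal_zero
  have hb2 : ContDiff ℝ (⊤ : ℕ∞) fun x => (φ n (x - w) : ℂ) :=
    Complex.ofRealCLM.contDiff.comp ((hφ.contDiff n).comp (contDiff_id.sub contDiff_const))
  have h := (hf (hb1.toSchwartzMap hb2)).2
  have h1 : ((∫ x, f x * φ n (x - w) : ℝ) : ℂ) =
      ∫ x, (f x : ℂ) * (hb1.toSchwartzMap hb2) x := by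
    rw [← integral_complex_ofReal]
    refine integral_congr_ae (ae_of_all _ fun x => ?_)
    change _ = (f x : ℂ) * (φ n (x - w) : ℂ)
    push_cast; rfl
  rw [h1, h]
  refine integral_congr_ae (ae_of_all _ fun ξ => ?_)
  change fourier (fun x => (φ n (x - w) : ℂ)) ξ =
    Complex.exp (-(Complex.I * ((inner ℝ ξ w : ℝ) : ℂ))) * r n ξ
  rw [← hφ.fourier n ξ, fourier, fourier, ← integral_const_mul, ← integral_add_right_eq_self _ w]
  refine integral_congr_ae (ae_of_all _ fun x => ?_)
  simp only [add_sub_cancel_right]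
  rw [← mul_assoc, ← Complex.exp_add, inner_add_right]
  congr 2
  push_cast; ring

lemma integrable_fourier_mollifier {d : ℕ} {μ : Measure (Space d)} [μ.HasTemperateGrowth]
    {φ r : ℕ → Space d → ℝ} (hφ : IsMollifier φ r) (n : ℕ) : Integrable (r n) μ := by
  have hb1 : HasCompactSupport fun x => (φ n x : ℂ) := (hφ.compact n).comp_left Complex.ofReal_zero
  have hb2 : ContDiff ℝ (⊤ : ℕ∞) fun x => (φ n x : ℂ) :=
    Complex.ofRealCLM.contDiff.comp (hφ.contDiff n)
  have h := (integrable_fourier_schwartz (μ := μ) (hb1.toSchwartzMap hb2)).re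
  refine h.congr (ae_of_all _ fun ξ => ?_)
  change Complex.re (fourier (fun x => (φ n x : ℂ)) ξ) = _
  rw [hφ.fourier, Complex.ofReal_re]

/-! ### Testing `f` against compactly supported measures of bounded density -/

section Bilinear

variable {d : ℕ} {f : Space d → ℝ} {μ : Measure (Space d)}

lemma integrable_of_le_smul_volume (hf : IsFourierTransformOf f μ) {ν : Measure (Space d)}
    {C : ℝ≥0} (hν : ν ≤ C • volume) {R : ℝ} (hR : 0 < R) (hνR : ∀ᵐ w ∂ν, w ∈ Metric.ball 0 R) :
    Integrable f ν := by
  have h1 : Integrable f ((C • volume : Measure (Space d)).restrict (Metric.ball 0 R)) := by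
    rw [Measure.restrict_smul]
    exact (hf.integrableOn_ball hR).smul_measure_nnreal
  refine h1.mono_measure ?_
  rw [← Measure.restrict_eq_self_of_ae_mem hνR]
  exact Measure.restrict_mono_measure hν _

/-- By Fubini, the integral against `μ` is the `φ n`-average over $y$ of $\int f(y+w)\,\nu(dw)$.
This function of $y$ is continuous at $0$: since `ν` is bounded by a multiple of Lebesgue measure,
that follows from continuity of translations in $L^1$. -/
lemma tendsto_integral_mollified (hf : IsFourierTransformOf f μ) [SigmaFinite μ]
    [μ.HasTemperateGrowth] {φ r : ℕ → Space d → ℝ} (hφ : IsMollifier φ r)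
    {ν : Measure (Space d)} [IsFiniteMeasure ν] {C : ℝ≥0} (hν : ν ≤ C • volume) {R : ℝ}
    (hR : 0 < R) (hνR : ∀ᵐ w ∂ν, w ∈ Metric.ball 0 R) :
    Tendsto (fun n => ∫ ξ, (∫ w, Complex.exp (-(Complex.I * ((inner ℝ ξ w : ℝ) : ℂ))) ∂ν) * r n ξ ∂μ)
      atTop (𝓝 ((∫ w, f w ∂ν : ℝ) : ℂ)) := by
  have hac : ν ≪ volume := Measure.absolutelyContinuous_of_le_smul
    (c := (C : ℝ≥0∞)) hν
  have hfR := hf.integrableOn_ball (R := R + 2) (by linarith)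
  -- `f` is only known to be locally integrable, so it is replaced by a globally integrable `g`. The
  -- radius `R + 2` leaves room for $y+w$ with $w$ in the ball of radius `R` and $y$ in the support
  -- of `φ n`.
  obtain ⟨g, hgm, hgi, hfg⟩ : ∃ g : Space d → ℝ, StronglyMeasurable g ∧ Integrable g ∧
      ∀ᵐ x, x ∈ Metric.ball (0 : Space d) (R + 2) → f x = g x := by
    have h1 : Integrable ((Metric.ball 0 (R + 2)).indicator f) :=
      (integrable_indicator_iff measurableSet_ball).2 hfR
    refine ⟨h1.1.mk _, h1.1.stronglyMeasurable_mk, h1.congr h1.1.ae_eq_mk, ?_⟩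
    filter_upwards [h1.1.ae_eq_mk] with x hx hxR
    rw [← hx, Set.indicator_of_mem hxR]
  have hgν : ∫ w, f w ∂ν = ∫ w, g w ∂ν := by
    refine integral_congr_ae ?_
    filter_upwards [hνR, hac.ae_le hfg] with w h1 h2
    exact h2 (Metric.ball_subset_ball (by linarith) h1)
  have hφcont : ∀ n, Continuous (φ n) := fun n => (hφ.contDiff n).continuous
  -- the translated mollifier tested against `f`
  have hA : ∀ n, ∀ w ∈ Metric.ball (0 : Space d) R,
      ∫ x, f x * φ n (x - w) = ∫ y, φ n y * g (y + w) := by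
    intro n w hw
    rw [← integral_add_right_eq_self (fun x => f x * φ n (x - w)) w]
    have hq : ∀ᵐ y, y + w ∈ Metric.ball (0 : Space d) (R + 2) → f (y + w) = g (y + w) :=
      (measurePreserving_add_right volume w).quasiMeasurePreserving.ae hfg
    refine integral_congr_ae ?_
    filter_upwards [hq] with y hy
    simp only [add_sub_cancel_right]
    by_cases h : φ n y = 0
    · simp [h]
    · have h2 := hφ.support_subset n h
      rw [mem_ball_zero_iff] at *
      rw [hy, mul_comm]
      linarith [norm_add_le y w]
  have hM : Tendsto (fun n => ∫ y, φ n y • ∫ w, g (y + w) ∂ν) atTop (𝓝 (∫ w, g (0 + w) ∂ν)) := by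
    refine tendsto_integral_mul_of_support hφ.nonneg hφ.integral hφ.support ?_ ?_
    · exact (StronglyMeasurable.integral_prod_right (f := fun y w => g (y + w))
        (hgm.comp_measurable measurable_add)).aestronglyMeasurable
    · have hgt : ∀ y, Integrable (fun w => g (y + w)) := fun y => hgi.comp_add_left y
      have hgtν : ∀ y, Integrable (fun w => g (y + w)) ν := fun y =>
        ((hgt y).smul_measure_nnreal (c := C)).mono_measure hν
      rw [ContinuousAt, tendsto_iff_norm_sub_tendsto_zero]
      have hz := (tendsto_integral_norm_translate hgi).const_mul (C : ℝ)
      rw [mul_zero] at hz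
      refine squeeze_zero (fun _ => norm_nonneg _) (fun y => ?_) hz
      rw [← integral_sub (hgtν y) (hgtν 0)]
      refine (norm_integral_le_integral_norm _).trans ?_
      have hd : Integrable (fun w => ‖g (y + w) - g w‖) := ((hgt y).sub hgi).norm
      calc ∫ w, ‖g (y + w) - g (0 + w)‖ ∂ν = ∫ w, ‖g (y + w) - g w‖ ∂ν := by simp
        _ ≤ ∫ w, ‖g (y + w) - g w‖ ∂(C • volume : Measure (Space d)) :=
            integral_mono_measure hν (ae_of_all _ fun _ => norm_nonneg _) hd.smul_measure_nnreal
        _ = C * ∫ w, ‖g (y + w) - g w‖ := by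
            rw [integral_smul_nnreal_measure]; rfl
  simp only [zero_add] at hM
  rw [← hgν] at hM
  have hM2 := (Complex.continuous_ofReal.tendsto _).comp hM
  refine hM2.congr fun n => ?_
  simp only [Function.comp_apply]
  have hF1 : ∫ y, φ n y • ∫ w, g (y + w) ∂ν = ∫ w, (∫ y, φ n y * g (y + w)) ∂ν := by
    simp_rw [smul_eq_mul, ← integral_const_mul]
    refine (integral_integral_swap ?_).symm
    obtain ⟨K, hK⟩ := (hφcont n).bounded_above_of_compact_support (hφ.compact n)
    have hi : ∀ w, Integrable fun y => φ n y * g (y + w) := fun w =>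
      (hgi.comp_add_right w).bdd_mul (hφcont n).aestronglyMeasurable (ae_of_all _ hK)
    have hmeas : StronglyMeasurable fun p : Space d × Space d => φ n p.2 * g (p.2 + p.1) :=
      ((hφcont n).stronglyMeasurable.comp_measurable measurable_snd).mul
        (hgm.comp_measurable (measurable_snd.add measurable_fst))
    refine (integrable_prod_iff hmeas.aestronglyMeasurable).2 ?_
    refine ⟨ae_of_all _ hi, ?_⟩
    refine Integrable.of_bound
      (hmeas.norm.integral_prod_right (f := fun w y => ‖φ n y * g (y + w)‖)).aestronglyMeasurable
      (K * ∫ y, ‖g y‖) (ae_of_all _ fun w => ?_)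
    rw [Real.norm_of_nonneg (integral_nonneg fun _ => norm_nonneg _),
      ← integral_add_right_eq_self (fun y => ‖g y‖) w, ← integral_const_mul]
    refine integral_mono (hi w).norm ((hgi.comp_add_right w).norm.const_mul K) fun y => ?_
    simp only [norm_mul]
    exact mul_le_mul_of_nonneg_right (hK y) (norm_nonneg _)
  rw [hF1, ← integral_complex_ofReal]
  have hF2 : ∫ w, ((∫ y, φ n y * g (y + w) : ℝ) : ℂ) ∂ν =
      ∫ w, ∫ ξ, Complex.exp (-(Complex.I * ((inner ℝ ξ w : ℝ) : ℂ))) * r n ξ ∂μ ∂ν := by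
    refine integral_congr_ae ?_
    filter_upwards [hνR] with w hw
    rw [← hA n w hw, integral_mul_translate_mollifier hf hφ]
  rw [hF2, integral_integral_swap]
  · refine integral_congr_ae (ae_of_all _ fun ξ => ?_)
    simp only
    rw [integral_mul_const]
  · have hr := (integrable_fourier_mollifier (μ := μ) hφ n)
    have hb : Integrable (fun p : Space d × Space d => (1 : ℝ) * r n p.2) (ν.prod μ) :=
      (integrable_const (1 : ℝ)).mul_prod hr
    refine hb.mono ?_ (ae_of_all _ fun p => ?_)
    · refine AEStronglyMeasurable.mul ?_ ?_
      · exact Continuous.aestronglyMeasurable (by fun_prop)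
      · exact Complex.continuous_ofReal.comp_aestronglyMeasurable hr.1.comp_snd
    · simp only [Function.uncurry, norm_mul, norm_exp_neg_I_mul, Complex.norm_real, norm_one, le_refl]

end Bilinear

/-! ### Plancherel identity for indicator functions of bounded sets -/

/-- The Fourier transform of the indicator function of a set. -/
def indFourier {d : ℕ} (A : Set (Space d)) (ξ : Space d) : ℂ :=
  fourier (fun y => ((A.indicator 1 y : ℝ) : ℂ)) ξ

/-- The law of `z - z'` for `z` in `A` and `z'` in `B`. -/
def diffMeasure {d : ℕ} (A B : Set (Space d)) : Measure (Space d) :=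
  ((volume.restrict A).prod (volume.restrict B)).map fun p => p.1 - p.2

section

variable {d : ℕ} {A B : Set (Space d)}

lemma indFourier_eq (hA : MeasurableSet A) (ξ : Space d) :
    indFourier A ξ = ∫ z in A, Complex.exp (-(Complex.I * ((inner ℝ ξ z : ℝ) : ℂ))) := by
  rw [indFourier, fourier, ← integral_indicator hA]
  refine integral_congr_ae (ae_of_all _ fun z => ?_)
  by_cases hz : z ∈ A <;> simp [hz]

lemma stronglyMeasurable_indFourier (hA : MeasurableSet A) :
    StronglyMeasurable (indFourier A) := by
  have : indFourier A =
      fun ξ => ∫ z in A, Complex.exp (-(Complex.I * ((inner ℝ ξ z : ℝ) : ℂ))) :=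
    funext (indFourier_eq hA)
  rw [this]
  exact StronglyMeasurable.integral_prod_right
    (f := fun ξ z : Space d => Complex.exp (-(Complex.I * ((inner ℝ ξ z : ℝ) : ℂ))))
    (Continuous.stronglyMeasurable (by fun_prop))

lemma norm_indFourier_le (hA : MeasurableSet A) (ξ : Space d) :
    ‖indFourier A ξ‖ ≤ volume.real A := by
  rw [indFourier_eq hA]
  refine (norm_integral_le_integral_norm _).trans_eq ?_
  simp [norm_exp_neg_I_mul]

/-- For fixed $z$ the map $z'\mapsto z-z'$ preserves Lebesgue measure; integrating over $z\in A$
gives the factor $|A|$. -/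
lemma diffMeasure_le (hAf : volume A ≠ ∞) (hBf : volume B ≠ ∞) :
    diffMeasure A B ≤ (volume A).toNNReal • volume := by
  have : IsFiniteMeasure (volume.restrict A) := ⟨by simpa using hAf.lt_top⟩
  have : IsFiniteMeasure (volume.restrict B) := ⟨by simpa using hBf.lt_top⟩
  refine Measure.le_iff.2 fun s hs => ?_
  rw [diffMeasure, Measure.map_apply measurable_sub hs,
    Measure.prod_apply (measurable_sub hs)]
  calc ∫⁻ x in A, (volume.restrict B) (Prod.mk x ⁻¹' ((fun p : Space d × Space d => p.1 - p.2) ⁻¹' s))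
      ≤ ∫⁻ x in A, volume s := by
        refine lintegral_mono fun x => (Measure.restrict_apply_le _ _).trans_eq ?_
        exact (Measure.measurePreserving_sub_left volume x).measure_preimage hs.nullMeasurableSet
    _ = volume A * volume s := by rw [lintegral_const, Measure.restrict_apply_univ, mul_comm]
    _ = _ := by
        rw [Measure.smul_apply, ENNReal.smul_def, ENNReal.coe_toNNReal hAf, smul_eq_mul]

lemma diffMeasure_ae_mem (hA : MeasurableSet A) (hB : MeasurableSet B)
    (hAf : volume A ≠ ∞) (hBf : volume B ≠ ∞) {R : ℝ}
    (hAR : A ⊆ Metric.ball 0 R) (hBR : B ⊆ Metric.ball 0 R) :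
    ∀ᵐ w ∂(diffMeasure A B), w ∈ Metric.ball 0 (R + R) := by
  have : IsFiniteMeasure (volume.restrict A) := ⟨by simpa using hAf.lt_top⟩
  have : IsFiniteMeasure (volume.restrict B) := ⟨by simpa using hBf.lt_top⟩
  refine (ae_map_iff (p := fun w => w ∈ Metric.ball 0 (R + R))
    (measurable_sub).aemeasurable measurableSet_ball).2 ?_
  rw [Measure.prod_restrict]
  filter_upwards [ae_restrict_mem (hA.prod hB)] with p hp
  have h1 := hAR hp.1
  have h2 := hBR hp.2
  rw [mem_ball_zero_iff] at *
  linarith [norm_sub_le p.1 p.2]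

lemma integral_exp_diffMeasure (hA : MeasurableSet A) (hB : MeasurableSet B)
    (hAf : volume A ≠ ∞) (hBf : volume B ≠ ∞) (ξ : Space d) :
    ∫ w, Complex.exp (-(Complex.I * ((inner ℝ ξ w : ℝ) : ℂ))) ∂(diffMeasure A B) =
      indFourier A ξ * (starRingEnd ℂ) (indFourier B ξ) := by
  have : IsFiniteMeasure (volume.restrict A) := ⟨by simpa using hAf.lt_top⟩
  have : IsFiniteMeasure (volume.restrict B) := ⟨by simpa using hBf.lt_top⟩
  rw [diffMeasure, integral_map (measurable_sub).aemeasurable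
    (Continuous.aestronglyMeasurable (by fun_prop)), indFourier_eq hA, indFourier_eq hB,
    ← integral_conj, ← integral_prod_mul]
  refine integral_congr_ae (ae_of_all _ fun p => ?_)
  simp only
  rw [← Complex.exp_conj, ← Complex.exp_add, inner_sub_right]
  congr 1
  simp
  ring

variable {f : Space d → ℝ} {μ : Measure (Space d)}

lemma integral_diffMeasure (hf : IsFourierTransformOf f μ) (hA : MeasurableSet A)
    (hB : MeasurableSet B) (hAb : Bornology.IsBounded A) (hBb : Bornology.IsBounded B) :
    ∫ w, f w ∂(diffMeasure A B) = ∫ z in A, ∫ z' in B, f (z - z') := by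
  have hAf := hAb.measure_lt_top (μ := volume) |>.ne
  have hBf := hBb.measure_lt_top (μ := volume) |>.ne
  have : IsFiniteMeasure (volume.restrict A) := ⟨by simpa using hAf.lt_top⟩
  have : IsFiniteMeasure (volume.restrict B) := ⟨by simpa using hBf.lt_top⟩
  obtain ⟨R, hR, hABR⟩ := (hAb.union hBb).subset_ball_lt 0 0
  have hfi := integrable_of_le_smul_volume hf (diffMeasure_le hAf hBf)
    (add_pos hR hR) (diffMeasure_ae_mem hA hB hAf hBf (Set.subset_union_left.trans hABR)
      (Set.subset_union_right.trans hABR))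
  rw [diffMeasure, integral_map (measurable_sub).aemeasurable hfi.1, integral_prod]
  exact (integrable_map_measure hfi.1 (measurable_sub).aemeasurable).1 hfi

lemma tendsto_integral_indFourier (hf : IsFourierTransformOf f μ) (hμ : IsTempered μ)
    {φ r : ℕ → Space d → ℝ} (hφ : IsMollifier φ r) (hA : MeasurableSet A)
    (hB : MeasurableSet B) (hAb : Bornology.IsBounded A) (hBb : Bornology.IsBounded B) :
    Tendsto (fun n => ∫ ξ, indFourier A ξ * (starRingEnd ℂ) (indFourier B ξ) * r n ξ ∂μ) atTop
      (𝓝 ((∫ z in A, ∫ z' in B, f (z - z') : ℝ) : ℂ)) := by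
  have := hμ.hasTemperateGrowth
  have := hμ.sigmaFinite
  have hAf := hAb.measure_lt_top (μ := volume) |>.ne
  have hBf := hBb.measure_lt_top (μ := volume) |>.ne
  have : IsFiniteMeasure (volume.restrict A) := ⟨by simpa using hAf.lt_top⟩
  have : IsFiniteMeasure (volume.restrict B) := ⟨by simpa using hBf.lt_top⟩
  have : IsFiniteMeasure (diffMeasure A B) := by unfold diffMeasure; infer_instance
  obtain ⟨R, hR, hABR⟩ := (hAb.union hBb).subset_ball_lt 0 0
  have h := tendsto_integral_mollified hf hφ (diffMeasure_le hAf hBf)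
    (add_pos hR hR) (diffMeasure_ae_mem hA hB hAf hBf (Set.subset_union_left.trans hABR)
      (Set.subset_union_right.trans hABR))
  rw [integral_diffMeasure hf hA hB hAb hBb] at h
  simpa only [integral_exp_diffMeasure hA hB hAf hBf] using h

/-- Fatou's lemma along the mollifiers: the integrals of $|\widehat{1_A}|^2 r_n\ge 0$ converge to
the finite number $\int_A\int_A f(z-z')\,dz'\,dz$, which therefore bounds the integral of the
pointwise limit. -/
lemma memLp_indFourier (hf : IsFourierTransformOf f μ) (hμ : IsTempered μ)
    (hA : MeasurableSet A) (hAb : Bornology.IsBounded A) : MemLp (indFourier A) 2 μ := by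
  obtain ⟨φ, r, hφ⟩ := exists_mollifier d
  have := hμ.hasTemperateGrowth
  have hmeas := (stronglyMeasurable_indFourier hA).aestronglyMeasurable (μ := μ)
  have hr : ∀ n, Integrable (r n) μ := integrable_fourier_mollifier hφ
  have hrm : ∀ n, Measurable (r n) := by
    intro n
    have h1 : r n = fun ξ => (fourier (fun x => (φ n x : ℂ)) ξ).re := by
      ext ξ; rw [hφ.fourier, Complex.ofReal_re]
    rw [h1]
    refine Complex.measurable_re.comp (StronglyMeasurable.measurable ?_)
    refine StronglyMeasurable.integral_prod_right (f := fun ξ x : Space d =>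
      Complex.exp (-(Complex.I * ((inner ℝ ξ x : ℝ) : ℂ))) * (φ n x : ℂ))
      (Continuous.stronglyMeasurable ?_)
    have := (hφ.contDiff n).continuous
    fun_prop
  have hi : ∀ n, Integrable (fun ξ => ‖indFourier A ξ‖ ^ 2 * r n ξ) μ := fun n =>
    (hr n).bdd_mul (c := volume.real A ^ 2) (hmeas.norm.pow 2) (ae_of_all _ fun ξ => by
      rw [norm_pow, norm_norm]
      exact pow_le_pow_left₀ (norm_nonneg _) (norm_indFourier_le hA ξ) 2)
  have h := tendsto_integral_indFourier hf hμ hφ hA hA hAb hAb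
  have h1 : Tendsto (fun n => ∫ ξ, ‖indFourier A ξ‖ ^ 2 * r n ξ ∂μ) atTop
      (𝓝 (∫ z in A, ∫ z' in A, f (z - z'))) := by
    have h2 := (Complex.continuous_re.tendsto _).comp h
    rw [Complex.ofReal_re] at h2
    refine h2.congr fun n => ?_
    rw [Function.comp_apply, ← Complex.ofReal_re (∫ ξ, ‖indFourier A ξ‖ ^ 2 * r n ξ ∂μ),
      ← integral_complex_ofReal]
    congr 2
    ext ξ
    rw [Complex.mul_conj, Complex.normSq_eq_norm_sq]
    push_cast; rfl
  rw [memLp_two_iff_integrable_sq_norm hmeas]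
  refine ⟨hmeas.norm.pow 2, ?_⟩
  rw [hasFiniteIntegral_iff_ofReal (ae_of_all _ fun _ => sq_nonneg _)]
  have hm2 : Measurable fun ξ => ‖indFourier A ξ‖ ^ 2 :=
    (stronglyMeasurable_indFourier hA).norm.measurable.pow_const 2
  calc ∫⁻ ξ, ENNReal.ofReal (‖indFourier A ξ‖ ^ 2) ∂μ
      = ∫⁻ ξ, liminf (fun n => ENNReal.ofReal (‖indFourier A ξ‖ ^ 2 * r n ξ)) atTop ∂μ := by
        refine lintegral_congr fun ξ => ?_
        refine (Tendsto.liminf_eq ?_).symm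
        have := ((hφ.tendsto ξ).const_mul (‖indFourier A ξ‖ ^ 2))
        rw [mul_one] at this
        exact (ENNReal.continuous_ofReal.tendsto _).comp this
    _ ≤ liminf (fun n => ∫⁻ ξ, ENNReal.ofReal (‖indFourier A ξ‖ ^ 2 * r n ξ) ∂μ) atTop :=
        lintegral_liminf_le fun n => (hm2.mul (hrm n)).ennreal_ofReal
    _ = ENNReal.ofReal (∫ z in A, ∫ z' in A, f (z - z')) := by
        refine Tendsto.liminf_eq ?_
        refine ((ENNReal.continuous_ofReal.tendsto _).comp h1).congr fun n => ?_
        exact ofReal_integral_eq_lintegral_ofReal (hi n)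
          (ae_of_all _ fun ξ => mul_nonneg (sq_nonneg _) (hφ.fourier_nonneg n ξ))
    _ < ∞ := ENNReal.ofReal_lt_top

/-- With square integrability known, the product of the two moduli dominates the mollified
integrands, so the multipliers `r n` can be removed in the limit. -/
lemma integral_indFourier_mul_conj (hf : IsFourierTransformOf f μ) (hμ : IsTempered μ)
    (hA : MeasurableSet A) (hB : MeasurableSet B) (hAb : Bornology.IsBounded A)
    (hBb : Bornology.IsBounded B) :
    ∫ ξ, indFourier A ξ * (starRingEnd ℂ) (indFourier B ξ) ∂μ =
      ((∫ z in A, ∫ z' in B, f (z - z') : ℝ) : ℂ) := by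
  obtain ⟨φ, r, hφ⟩ := exists_mollifier d
  have := hμ.hasTemperateGrowth
  refine tendsto_nhds_unique ?_ (tendsto_integral_indFourier hf hμ hφ hA hB hAb hBb)
  have hmA := (stronglyMeasurable_indFourier hA).aestronglyMeasurable (μ := μ)
  have hmB := (stronglyMeasurable_indFourier hB).aestronglyMeasurable (μ := μ)
  have hmAB : AEStronglyMeasurable
      (fun ξ => indFourier A ξ * (starRingEnd ℂ) (indFourier B ξ)) μ :=
    hmA.mul (Complex.continuous_conj.comp_aestronglyMeasurable hmB)
  refine tendsto_integral_of_dominated_convergence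
    (fun ξ => ‖indFourier A ξ‖ * ‖indFourier B ξ‖) (fun n => ?_) ?_ (fun n => ?_) ?_
  · exact hmAB.mul (Complex.continuous_ofReal.comp_aestronglyMeasurable
      (integrable_fourier_mollifier hφ n).1)
  · exact (memLp_indFourier hf hμ hA hAb).norm.integrable_mul (memLp_indFourier hf hμ hB hBb).norm
  · refine ae_of_all _ fun ξ => ?_
    rw [norm_mul, norm_mul, RCLike.norm_conj, Complex.norm_real,
      Real.norm_of_nonneg (hφ.fourier_nonneg n ξ)]
    exact mul_le_of_le_one_right (by positivity) (hφ.fourier_le n ξ)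
  · refine ae_of_all _ fun ξ => ?_
    have := ((Complex.continuous_ofReal.tendsto _).comp (hφ.tendsto ξ)).const_mul
      (indFourier A ξ * (starRingEnd ℂ) (indFourier B ξ))
    simpa using this

end

/-! ### The time transform and its isometry property -/

/-- The transform `∫ (u - s)_+ ^ (H - 3/2) a(u, ξ) du`, which maps the space of integrands
isometrically (up to a constant) to an `L²` space. -/
def timeTransform {d : ℕ} (H : ℝ) (a : ℝ → Space d → ℂ) (p : Space d × ℝ) : ℂ :=
  ∫ u, (fracKernel H u p.2 : ℂ) * a u p.1

/-- The time-space functions with square integrable absolute time transform. -/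
structure IsTransformable {d : ℕ} (H : ℝ) (μ : Measure (Space d)) (a : ℝ → Space d → ℂ) :
    Prop where
  measurable : Measurable fun p : ℝ × Space d => a p.1 p.2
  lintegral_lt_top : ∫⁻ ξ, (∫⁻ s, (∫⁻ u, ENNReal.ofReal (fracKernel H u s) * ‖a u ξ‖ₑ) ^ 2) ∂μ < ∞

-- Expand the square as a double integral, apply Tonelli and integrate out $s$ first. The diagonal
-- $u=v$, where the factorization is not available, is a null set.
set_option maxHeartbeats 1000000 in
lemma lintegral_sq_fracKernel (H : ℝ) {b : ℝ → ℝ≥0∞} (hb : Measurable b) :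
    ∫⁻ s, (∫⁻ u, ENNReal.ofReal (fracKernel H u s) * b u) ^ 2 =
      kernelConst H * ∫⁻ u, ∫⁻ v, ENNReal.ofReal (|u - v| ^ (2 * H - 2)) * (b u * b v) := by
  have hk := (measurable_fracKernel H).ennreal_ofReal
  have hk1 : ∀ w, Measurable fun u => ENNReal.ofReal (fracKernel H u w) := fun w =>
    (measurable_fracKernel_left H w).ennreal_ofReal
  have hkb : ∀ w, Measurable fun u => ENNReal.ofReal (fracKernel H u w) * b u := fun w =>
    (hk1 w).mul hb
  have hk3 : Measurable fun p : (ℝ × ℝ) × ℝ =>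
      (ENNReal.ofReal (fracKernel H p.1.2 p.1.1) * b p.1.2) *
        (ENNReal.ofReal (fracKernel H p.2 p.1.1) * b p.2) :=
    ((hk.comp (measurable_swap.comp measurable_fst)).mul
      (hb.comp (measurable_snd.comp measurable_fst))).mul
      ((hk.comp (measurable_snd.prodMk (measurable_fst.comp measurable_fst))).mul
        (hb.comp measurable_snd))
  calc ∫⁻ s, (∫⁻ u, ENNReal.ofReal (fracKernel H u s) * b u) ^ 2
      = ∫⁻ s, ∫⁻ u, ∫⁻ v, (ENNReal.ofReal (fracKernel H u s) * b u) *
          (ENNReal.ofReal (fracKernel H v s) * b v) := by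
        refine lintegral_congr fun s => ?_
        rw [sq, ← lintegral_mul_const _ (hkb s)]
        refine lintegral_congr fun u => ?_
        rw [lintegral_const_mul _ (hkb s)]
    _ = ∫⁻ u, ∫⁻ s, ∫⁻ v, (ENNReal.ofReal (fracKernel H u s) * b u) *
          (ENNReal.ofReal (fracKernel H v s) * b v) :=
        lintegral_lintegral_swap (Measurable.aemeasurable hk3.lintegral_prod_right')
    _ = ∫⁻ u, ∫⁻ v, ∫⁻ s, (ENNReal.ofReal (fracKernel H u s) * b u) *
          (ENNReal.ofReal (fracKernel H v s) * b v) := by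
        refine lintegral_congr fun u => lintegral_lintegral_swap (Measurable.aemeasurable ?_)
        exact hk3.comp ((measurable_fst.prodMk measurable_const).prodMk measurable_snd)
    _ = ∫⁻ u, ∫⁻ v, kernelConst H * (ENNReal.ofReal (|u - v| ^ (2 * H - 2)) * (b u * b v)) := by
        refine lintegral_congr fun u => lintegral_congr_ae ?_
        filter_upwards [volume.ae_ne u] with v hv
        have hks : ∀ w, Measurable fun s => ENNReal.ofReal (fracKernel H w s) := fun w =>
          hk.comp (measurable_const.prodMk measurable_id)
        have hks2 : Measurable fun s =>
            ENNReal.ofReal (fracKernel H u s) * ENNReal.ofReal (fracKernel H v s) :=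
          (hks u).mul (hks v)
        rw [← mul_assoc, ← lintegral_fracKernel_mul H hv.symm, ← lintegral_mul_const _ hks2]
        refine lintegral_congr fun s => ?_
        ring
    _ = _ := by
        have hm : Measurable fun p : ℝ × ℝ =>
            ENNReal.ofReal (|p.1 - p.2| ^ (2 * H - 2)) * (b p.1 * b p.2) := by fun_prop
        have hm' : Measurable fun u => ∫⁻ v,
            ENNReal.ofReal (|u - v| ^ (2 * H - 2)) * (b u * b v) := hm.lintegral_prod_right'
        rw [← lintegral_const_mul _ hm']
        refine lintegral_congr fun u => ?_
        have hmu : Measurable fun v =>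
            ENNReal.ofReal (|u - v| ^ (2 * H - 2)) * (b u * b v) :=
          hm.comp (measurable_const.prodMk measurable_id)
        rw [lintegral_const_mul _ hmu]

section

variable {d : ℕ} {H : ℝ} {μ : Measure (Space d)} {a b c : ℝ → Space d → ℂ}

lemma measurable_lintegral_fracKernel (ha : Measurable fun p : ℝ × Space d => a p.1 p.2) :
    Measurable fun p : Space d × ℝ =>
      ∫⁻ u, ENNReal.ofReal (fracKernel H u p.2) * ‖a u p.1‖ₑ := by
  refine Measurable.lintegral_prod_right' (f := fun q : (Space d × ℝ) × ℝ =>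
    ENNReal.ofReal (fracKernel H q.2 q.1.2) * ‖a q.2 q.1.1‖ₑ) ?_
  exact ((measurable_fracKernel H).ennreal_ofReal.comp
    (measurable_snd.prodMk (measurable_snd.comp measurable_fst))).mul
    (ha.comp (measurable_snd.prodMk (measurable_fst.comp measurable_fst))).enorm

lemma stronglyMeasurable_timeTransform (ha : Measurable fun p : ℝ × Space d => a p.1 p.2) :
    StronglyMeasurable (timeTransform H a) := by
  refine StronglyMeasurable.integral_prod_right' (f := fun q : (Space d × ℝ) × ℝ =>
    (fracKernel H q.2 q.1.2 : ℂ) * a q.2 q.1.1) (Measurable.stronglyMeasurable ?_)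
  exact (Complex.measurable_ofReal.comp ((measurable_fracKernel H).comp
    (measurable_snd.prodMk (measurable_snd.comp measurable_fst)))).mul
    (ha.comp (measurable_snd.prodMk (measurable_fst.comp measurable_fst)))

lemma enorm_fracKernel_mul (H u s : ℝ) (z : ℂ) :
    ‖(fracKernel H u s : ℂ) * z‖ₑ = ENNReal.ofReal (fracKernel H u s) * ‖z‖ₑ := by
  rw [enorm_mul, ← ofReal_norm, Complex.norm_real,
    Real.norm_of_nonneg (fracKernel_nonneg _ _ _)]

-- Uses $(x+y)^2\le 2x^2+2y^2$. The bound is asked only at almost every time, but there for all `ξ`,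
-- because admissible integrands are integrable in space only at almost every time.
set_option maxHeartbeats 1000000 in
lemma IsTransformable.of_norm_le (ha : IsTransformable H μ a) (hb : IsTransformable H μ b)
    (hc : Measurable fun p : ℝ × Space d => c p.1 p.2)
    (h : ∀ᵐ u, ∀ ξ, ‖c u ξ‖ ≤ ‖a u ξ‖ + ‖b u ξ‖) : IsTransformable H μ c := by
  refine ⟨hc, ?_⟩
  have hma := measurable_lintegral_fracKernel (H := H) ha.measurable
  have hmb := measurable_lintegral_fracKernel (H := H) hb.measurable
  have hms : ∀ (e : ℝ → Space d → ℂ) (_ : Measurable fun p : ℝ × Space d => e p.1 p.2) ξ s,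
      Measurable fun u => ENNReal.ofReal (fracKernel H u s) * ‖e u ξ‖ₑ := fun e he ξ s =>
    (measurable_fracKernel_left H s).ennreal_ofReal.mul
      (he.comp (measurable_id.prodMk measurable_const)).enorm
  have hpt : ∀ ξ s, (∫⁻ u, ENNReal.ofReal (fracKernel H u s) * ‖c u ξ‖ₑ) ^ 2 ≤
      2 * (∫⁻ u, ENNReal.ofReal (fracKernel H u s) * ‖a u ξ‖ₑ) ^ 2 +
      2 * (∫⁻ u, ENNReal.ofReal (fracKernel H u s) * ‖b u ξ‖ₑ) ^ 2 := by
    intro ξ s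
    have h1 : ∫⁻ u, ENNReal.ofReal (fracKernel H u s) * ‖c u ξ‖ₑ ≤
        (∫⁻ u, ENNReal.ofReal (fracKernel H u s) * ‖a u ξ‖ₑ) +
          ∫⁻ u, ENNReal.ofReal (fracKernel H u s) * ‖b u ξ‖ₑ := by
      rw [← lintegral_add_left (hms a ha.measurable ξ s)]
      refine lintegral_mono_ae ?_
      filter_upwards [h] with u hu
      rw [← mul_add]
      gcongr
      rw [← ofReal_norm, ← ofReal_norm, ← ofReal_norm,
        ← ENNReal.ofReal_add (norm_nonneg _) (norm_nonneg _)]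
      exact ENNReal.ofReal_le_ofReal (hu ξ)
    refine (pow_le_pow_left₀ zero_le h1 2).trans ?_
    have := ENNReal.rpow_add_le_mul_rpow_add_rpow
      (∫⁻ u, ENNReal.ofReal (fracKernel H u s) * ‖a u ξ‖ₑ)
      (∫⁻ u, ENNReal.ofReal (fracKernel H u s) * ‖b u ξ‖ₑ) (p := 2) one_le_two
    norm_num at this
    rwa [mul_add] at this
  have hsq : ∀ (e : ℝ → Space d → ℂ) (_ : Measurable fun p : ℝ × Space d => e p.1 p.2),
      Measurable fun p : Space d × ℝ =>
        2 * (∫⁻ u, ENNReal.ofReal (fracKernel H u p.2) * ‖e u p.1‖ₑ) ^ 2 := fun e he =>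
    ((measurable_lintegral_fracKernel (H := H) he).pow_const 2).const_mul 2
  have hsq' : ∀ (e : ℝ → Space d → ℂ) (_ : IsTransformable H μ e),
      ∫⁻ ξ, (∫⁻ s, 2 * (∫⁻ u, ENNReal.ofReal (fracKernel H u s) * ‖e u ξ‖ₑ) ^ 2) ∂μ < ∞ := by
    intro e he
    simp_rw [lintegral_const_mul' 2 _ ENNReal.ofNat_ne_top]
    exact ENNReal.mul_lt_top ENNReal.ofNat_lt_top he.lintegral_lt_top
  calc _ ≤ ∫⁻ ξ, ((∫⁻ s, 2 * (∫⁻ u, ENNReal.ofReal (fracKernel H u s) * ‖a u ξ‖ₑ) ^ 2) +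
      ∫⁻ s, 2 * (∫⁻ u, ENNReal.ofReal (fracKernel H u s) * ‖b u ξ‖ₑ) ^ 2) ∂μ := by
        refine lintegral_mono fun ξ => ?_
        have hmξ : Measurable fun s =>
            2 * (∫⁻ u, ENNReal.ofReal (fracKernel H u s) * ‖a u ξ‖ₑ) ^ 2 :=
          (hsq a ha.measurable).comp (measurable_const.prodMk measurable_id)
        rw [← lintegral_add_left hmξ]
        exact lintegral_mono fun s => hpt ξ s
    _ < ∞ := by
        have hm' : Measurable fun ξ => ∫⁻ s,
            2 * (∫⁻ u, ENNReal.ofReal (fracKernel H u s) * ‖a u ξ‖ₑ) ^ 2 :=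
          (hsq a ha.measurable).lintegral_prod_right'
        rw [lintegral_add_left hm']
        exact ENNReal.add_lt_top.2 ⟨hsq' a ha, hsq' b hb⟩

lemma measurable_spaceFourier {g : ℝ → Space d → ℝ}
    (hg : Measurable fun p : ℝ × Space d => g p.1 p.2) :
    Measurable fun p : ℝ × Space d => spaceFourier g p.1 p.2 := by
  refine (StronglyMeasurable.integral_prod_right' (f := fun q : (ℝ × Space d) × Space d =>
    Complex.exp (-(Complex.I * ((inner ℝ q.1.2 q.2 : ℝ) : ℂ))) * (g q.1.1 q.2 : ℂ)) 
    (Measurable.stronglyMeasurable ?_)).measurable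
  refine Measurable.mul (Continuous.measurable (by fun_prop)) ?_
  exact Complex.measurable_ofReal.comp
    (hg.comp ((measurable_fst.comp measurable_fst).prodMk measurable_snd))

lemma IsAdmissible.isTransformable (hH : 1 / 2 < H) (hH1 : H < 1) {g : ℝ → Space d → ℝ}
    (hg : IsAdmissible H μ g) : IsTransformable H μ (spaceFourier g) := by
  refine ⟨measurable_spaceFourier hg.measurable, ?_⟩
  have hm := measurable_spaceFourier hg.measurable
  have h : ∀ ξ, ∫⁻ s, (∫⁻ u, ENNReal.ofReal (fracKernel H u s) * ‖spaceFourier g u ξ‖ₑ) ^ 2 =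
      kernelConst H * ∫⁻ u : ℝ, ∫⁻ v : ℝ, ENNReal.ofReal (|u - v| ^ (2 * H - 2) *
        (‖spaceFourier g u ξ‖ * ‖spaceFourier g v ξ‖)) := by
    intro ξ
    have hmξ : Measurable fun u => ‖spaceFourier g u ξ‖ₑ :=
      (hm.comp (measurable_id.prodMk measurable_const)).enorm
    rw [lintegral_sq_fracKernel H hmξ]
    congr 1
    refine lintegral_congr fun u => lintegral_congr fun v => ?_
    rw [ENNReal.ofReal_mul (Real.rpow_nonneg (abs_nonneg _) _),
      ENNReal.ofReal_mul (norm_nonneg _), ofReal_norm, ofReal_norm]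
  simp_rw [h]
  rw [lintegral_const_mul' _ _ (kernelConst_lt_top hH hH1).ne]
  exact ENNReal.mul_lt_top (kernelConst_lt_top hH hH1) hg.abs_lt_top

lemma IsTransformable.lintegral_prod_lt_top (ha : IsTransformable H μ a) :
    ∫⁻ p, (∫⁻ u, ENNReal.ofReal (fracKernel H u p.2) * ‖a u p.1‖ₑ) ^ 2 ∂(μ.prod volume) < ∞ := by
  rw [lintegral_prod _ ((measurable_lintegral_fracKernel ha.measurable).pow_const 2).aemeasurable]
  exact ha.lintegral_lt_top

lemma integrable_fracKernel_mul (ha : Measurable fun p : ℝ × Space d => a p.1 p.2) {ξ : Space d}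
    {s : ℝ} (h : (∫⁻ u, ENNReal.ofReal (fracKernel H u s) * ‖a u ξ‖ₑ) ^ 2 < ∞) :
    Integrable fun u => (fracKernel H u s : ℂ) * a u ξ := by
  refine ⟨(Measurable.mul (Complex.measurable_ofReal.comp (measurable_fracKernel_left H s))
    (ha.comp (measurable_id.prodMk measurable_const))).aestronglyMeasurable, ?_⟩
  rw [hasFiniteIntegral_iff_enorm]
  simp_rw [enorm_fracKernel_mul]
  exact (ENNReal.pow_lt_top_iff.1 h).resolve_right two_ne_zero

lemma IsTransformable.ae_integrable (ha : IsTransformable H μ a) :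
    ∀ᵐ p ∂(μ.prod volume), Integrable fun u => (fracKernel H u p.2 : ℂ) * a u p.1 := by
  filter_upwards [ae_lt_top ((measurable_lintegral_fracKernel (H := H) ha.measurable).pow_const 2)
    ha.lintegral_prod_lt_top.ne] with p hp
  exact integrable_fracKernel_mul ha.measurable hp

lemma IsTransformable.memLp (ha : IsTransformable H μ a) :
    MemLp (timeTransform H a) 2 (μ.prod volume) := by
  have hm := (stronglyMeasurable_timeTransform (H := H) ha.measurable)
  refine ⟨hm.aestronglyMeasurable, ?_⟩
  rw [eLpNorm_lt_top_iff_lintegral_rpow_enorm_lt_top two_ne_zero ENNReal.ofNat_ne_top]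
  simp only [ENNReal.toReal_ofNat, ENNReal.rpow_ofNat]
  refine lt_of_le_of_lt (lintegral_mono fun p => ?_) ha.lintegral_prod_lt_top
  refine pow_le_pow_left₀ zero_le ((enorm_integral_le_lintegral_enorm _).trans_eq ?_) 2
  simp_rw [enorm_fracKernel_mul]

/-- Linearity holds only almost everywhere: the integrals defining the transforms are known to
converge at almost every $(\xi,s)$. -/
lemma timeTransform_add_mul_ae (ha : IsTransformable H μ a) (hb : IsTransformable H μ b) (σ : ℂ)
    (h : ∀ᵐ u, ∀ ξ, c u ξ = a u ξ + σ * b u ξ) :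
    timeTransform H c =ᵐ[μ.prod volume]
      fun p => timeTransform H a p + σ * timeTransform H b p := by
  filter_upwards [ha.ae_integrable, hb.ae_integrable] with p h1 h2
  rw [timeTransform, timeTransform, timeTransform, ← integral_const_mul,
    ← integral_add h1 (h2.const_mul σ)]
  refine integral_congr_ae ?_
  filter_upwards [h] with u hu
  rw [hu]
  ring

lemma integral_fracKernel_mul {u v : ℝ} (huv : u ≠ v) :
    ∫ s, fracKernel H u s * fracKernel H v s =
      (kernelConst H).toReal * |u - v| ^ (2 * H - 2) := by
  have hks : ∀ w, Measurable fun s => fracKernel H w s := fun w =>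
    (measurable_fracKernel H).comp (measurable_const.prodMk measurable_id)
  rw [integral_eq_lintegral_of_nonneg_ae (ae_of_all _ fun s =>
    mul_nonneg (fracKernel_nonneg _ _ _) (fracKernel_nonneg _ _ _))
    ((hks u).mul (hks v)).aestronglyMeasurable]
  simp_rw [ENNReal.ofReal_mul (fracKernel_nonneg H u _)]
  rw [lintegral_fracKernel_mul H huv, ENNReal.toReal_mul,
    ENNReal.toReal_ofReal (Real.rpow_nonneg (abs_nonneg _) _)]

/-- The signed form of `lintegral_sq_fracKernel` at one frequency. Its absolute version is finite by
`hfin`, which makes the three-variable integrand `K` integrable and justifies Fubini. -/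
lemma integral_norm_sq_timeTransform (ha : Measurable fun p : ℝ × Space d => a p.1 p.2)
    {ξ : Space d} (hfin : ∫⁻ s, (∫⁻ u, ENNReal.ofReal (fracKernel H u s) * ‖a u ξ‖ₑ) ^ 2 < ∞) :
    ∫ s, ‖timeTransform H a (ξ, s)‖ ^ 2 = (kernelConst H).toReal *
      ∫ u : ℝ, ∫ v : ℝ, |u - v| ^ (2 * H - 2) * (a u ξ * (starRingEnd ℂ) (a v ξ)).re := by
  have hL : Measurable fun s => ∫⁻ u, ENNReal.ofReal (fracKernel H u s) * ‖a u ξ‖ₑ :=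
    (measurable_lintegral_fracKernel ha).comp (measurable_const.prodMk measurable_id)
  have haξ : Measurable fun u => a u ξ := ha.comp (measurable_id.prodMk measurable_const)
  let K : ℝ → ℝ × ℝ → ℝ := fun s z => fracKernel H z.1 s * fracKernel H z.2 s *
    (a z.1 ξ * (starRingEnd ℂ) (a z.2 ξ)).re
  have hKm : Measurable (Function.uncurry K) := by
    have hk := measurable_fracKernel H
    have h1 : Measurable fun q : ℝ × ℝ × ℝ => fracKernel H q.2.1 q.1 :=
      hk.comp ((measurable_fst.comp measurable_snd).prodMk measurable_fst)
    have h2 : Measurable fun q : ℝ × ℝ × ℝ => fracKernel H q.2.2 q.1 :=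
      hk.comp ((measurable_snd.comp measurable_snd).prodMk measurable_fst)
    have h3 : Measurable fun q : ℝ × ℝ × ℝ => a q.2.1 ξ :=
      haξ.comp (measurable_fst.comp measurable_snd)
    have h4 : Measurable fun q : ℝ × ℝ × ℝ => a q.2.2 ξ :=
      haξ.comp (measurable_snd.comp measurable_snd)
    exact (h1.mul h2).mul (Complex.measurable_re.comp
      (h3.mul (Complex.continuous_conj.measurable.comp h4)))
  have hKn : ∀ s z, ‖K s z‖ₑ ≤ (ENNReal.ofReal (fracKernel H z.1 s) * ‖a z.1 ξ‖ₑ) *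
      (ENNReal.ofReal (fracKernel H z.2 s) * ‖a z.2 ξ‖ₑ) := by
    intro s z
    rw [← enorm_fracKernel_mul, ← enorm_fracKernel_mul, ← enorm_mul, ← ofReal_norm,
      ← ofReal_norm]
    refine ENNReal.ofReal_le_ofReal ?_
    simp only [K, norm_mul, Complex.norm_real]
    have := (Complex.abs_re_le_norm (a z.1 ξ * (starRingEnd ℂ) (a z.2 ξ)))
    rw [norm_mul, RCLike.norm_conj] at this
    calc _ ≤ ‖fracKernel H z.1 s‖ * ‖fracKernel H z.2 s‖ * (‖a z.1 ξ‖ * ‖a z.2 ξ‖) := by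
          gcongr
          exact this
      _ = _ := by ring
  have hKi : Integrable (Function.uncurry K) (volume.prod volume) := by
    refine ⟨hKm.aestronglyMeasurable, ?_⟩
    rw [hasFiniteIntegral_iff_enorm, lintegral_prod _ hKm.enorm.aemeasurable]
    refine lt_of_le_of_lt (lintegral_mono fun s => ?_) hfin
    have hms : Measurable fun u => ENNReal.ofReal (fracKernel H u s) * ‖a u ξ‖ₑ :=
      (measurable_fracKernel_left H s).ennreal_ofReal.mul haξ.enorm
    refine (lintegral_mono fun z => hKn s z).trans_eq ?_
    rw [Measure.volume_eq_prod, lintegral_prod_mul hms.aemeasurable hms.aemeasurable, sq]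
  have h1 : ∀ᵐ s, ‖timeTransform H a (ξ, s)‖ ^ 2 = ∫ z, K s z := by
    filter_upwards [ae_lt_top (hL.pow_const 2) hfin.ne] with s hs
    have hi := integrable_fracKernel_mul ha hs
    have hic : Integrable fun u => (starRingEnd ℂ) ((fracKernel H u s : ℂ) * a u ξ) :=
      (Complex.conjCLE.integrable_comp_iff).2 hi
    have h2 : ((‖timeTransform H a (ξ, s)‖ ^ 2 : ℝ) : ℂ) = ∫ z : ℝ × ℝ,
        ((fracKernel H z.1 s : ℂ) * a z.1 ξ) *
          (starRingEnd ℂ) ((fracKernel H z.2 s : ℂ) * a z.2 ξ) := by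
      rw [Measure.volume_eq_prod, integral_prod_mul (fun u => (fracKernel H u s : ℂ) * a u ξ)
        (fun u => (starRingEnd ℂ) ((fracKernel H u s : ℂ) * a u ξ)), integral_conj,
        ← Complex.normSq_eq_norm_sq, ← Complex.mul_conj]
      rfl
    rw [← Complex.ofReal_re (‖timeTransform H a (ξ, s)‖ ^ 2), h2, ← RCLike.re_eq_complex_re,
      Measure.volume_eq_prod, ← integral_re (hi.mul_prod hic)]
    refine integral_congr_ae (ae_of_all _ fun z => ?_)
    simp only [K, RCLike.re_eq_complex_re, map_mul, Complex.conj_ofReal]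
    rw [show (fracKernel H z.1 s : ℂ) * a z.1 ξ *
      ((fracKernel H z.2 s : ℂ) * (starRingEnd ℂ) (a z.2 ξ)) =
      ((fracKernel H z.1 s * fracKernel H z.2 s : ℝ) : ℂ) *
        (a z.1 ξ * (starRingEnd ℂ) (a z.2 ξ)) by push_cast; ring, Complex.re_ofReal_mul]
  rw [integral_congr_ae h1]
  refine (integral_integral_swap hKi).trans ?_
  refine (integral_prod _ hKi.integral_prod_right).trans ?_
  rw [← integral_const_mul]
  refine integral_congr_ae (ae_of_all _ fun u => ?_)
  simp only
  rw [← integral_const_mul]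
  refine integral_congr_ae ?_
  filter_upwards [volume.ae_ne u] with v hv
  simp only [K, Function.uncurry]
  rw [integral_mul_const, integral_fracKernel_mul hv.symm, mul_assoc]

lemma IsTransformable.integral_norm_sq [SFinite μ] (ha : IsTransformable H μ a) :
    ∫ p, ‖timeTransform H a p‖ ^ 2 ∂(μ.prod volume) = (kernelConst H).toReal *
      ∫ ξ, (∫ u : ℝ, ∫ v : ℝ, |u - v| ^ (2 * H - 2) *
        (a u ξ * (starRingEnd ℂ) (a v ξ)).re) ∂μ := by
  have hi := ha.memLp.integrable_norm_pow two_ne_zero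
  have hL := ((measurable_lintegral_fracKernel (H := H) ha.measurable).pow_const
    2).lintegral_prod_right' (ν := volume)
  rw [integral_prod _ hi, ← integral_const_mul]
  refine integral_congr_ae ?_
  filter_upwards [ae_lt_top hL ha.lintegral_lt_top.ne] with ξ hξ
  exact integral_norm_sq_timeTransform ha.measurable hξ

end

/-! ### Gram matrices of boxes and the operator they define -/

/-- Two families in Hilbert spaces with proportional Gram matrices are related by a bounded
operator. -/
lemma exists_clm_of_gram {ι E F : Type*} [NormedAddCommGroup E] [InnerProductSpace ℝ E]
    [CompleteSpace E] [NormedAddCommGroup F] [InnerProductSpace ℝ F] [CompleteSpace F]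
    (b : ι → F) (v : ι → E) {K : ℝ} (hK : 0 ≤ K)
    (h : ∀ i j, inner ℝ (v i) (v j) = K * inner ℝ (b i) (b j)) :
    ∃ A : F →L[ℝ] E, ∀ i, A (b i) = v i := by
  let lb := Finsupp.linearCombination ℝ b
  let lv := Finsupp.linearCombination ℝ v
  have hin : ∀ c, inner ℝ (lv c) (lv c) = K * inner ℝ (lb c) (lb c) := by
    intro c
    simp only [lb, lv, Finsupp.linearCombination_apply, Finsupp.sum, sum_inner, inner_sum,
      inner_smul_left, inner_smul_right, h, Finset.mul_sum]
    refine Finset.sum_congr rfl fun i _ => Finset.sum_congr rfl fun j _ => ?_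
    ring
  have hnorm : ∀ c, ‖lv c‖ ≤ √K * ‖lb c‖ := by
    intro c
    have h1 := hin c
    rw [real_inner_self_eq_norm_sq, real_inner_self_eq_norm_sq] at h1
    refine abs_le_of_sq_le_sq' ?_ (by positivity) |>.2
    rw [h1, mul_pow, Real.sq_sqrt hK]
  -- By `hnorm`, `lv` factors through `lb` with bound `√K`, even where `lb` is not injective. The
  -- operator is its continuous extension to the closed span `S`, preceded by the orthogonal
  -- projection onto `S`.
  let S := (LinearMap.range lb).topologicalClosure
  have : CompleteSpace S := (Submodule.isClosed_topologicalClosure _).completeSpace_coe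
  let e : (ι →₀ ℝ) →ₗ[ℝ] S := lb.codRestrict S fun c =>
    Submodule.le_topologicalClosure _ (LinearMap.mem_range_self lb c)
  have hdense : DenseRange e := by
    intro x
    rw [mem_closure_iff_seq_limit]
    obtain ⟨y, hy, hyx⟩ := mem_closure_iff_seq_limit.1 x.2
    choose c hc using hy
    refine ⟨fun n => e (c n), fun n => Set.mem_range_self _, ?_⟩
    rw [tendsto_subtype_rng]
    refine hyx.congr fun n => ?_
    rw [← hc n]
    rfl
  refine ⟨(lv.extendOfNorm e).comp (S.orthogonalProjectionOnto), fun i => ?_⟩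
  have hbi : b i = (e (Finsupp.single i 1) : F) := by
    simp [e, lb]
  rw [ContinuousLinearMap.comp_apply, hbi, Submodule.orthogonalProjectionOnto_mem_subspace_eq_self,
    LinearMap.extendOfNorm_eq hdense ⟨√K, hnorm⟩]
  simp [lv]

section

variable {Ω : Type*} [MeasurableSpace Ω] {P : Measure Ω} {d : ℕ} {H : ℝ}
  {f : Space d → ℝ} {μ : Measure (Space d)} {W : ℝ → BoundedBorel d → Ω → ℝ}

/-- The time transform of the indicator function of a box. -/
def boxTransform (H : ℝ) (B : Box d) (p : Space d × ℝ) : ℂ :=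
  indFourier B.base.1 p.1 * (kernelInt H B.left B.right p.2 : ℂ)

/-- The noise of a box. -/
def boxNoise {Ω : Type*} (W : ℝ → BoundedBorel d → Ω → ℝ) (B : Box d) (ω : Ω) : ℝ :=
  W B.right B.base ω - W B.left B.base ω

lemma integrable_indFourier_mul_conj (hf : IsFourierTransformOf f μ) (hμ : IsTempered μ)
    (A B : BoundedBorel d) :
    Integrable (fun ξ => indFourier A.1 ξ * (starRingEnd ℂ) (indFourier B.1 ξ)) μ := by
  have h2 : MemLp (fun ξ => (starRingEnd ℂ) (indFourier B.1 ξ)) 2 μ :=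
    (memLp_indFourier hf hμ B.2.1 B.2.2).star
  exact (memLp_indFourier hf hμ A.2.1 A.2.2).integrable_mul h2

lemma memLp_boxTransform (hH : 1 / 2 < H) (hH1 : H < 1) (hf : IsFourierTransformOf f μ)
    (hμ : IsTempered μ) (B : Box d) : MemLp (boxTransform H B) 2 (μ.prod volume) := by
  have := hμ.sigmaFinite
  have h1 := memLp_indFourier hf hμ B.base.2.1 B.base.2.2
  have h2 := memLp_kernelInt hH hH1 B.left_le_right
  have hm : AEStronglyMeasurable (boxTransform H B) (μ.prod volume) :=
    h1.1.comp_fst.mul (Complex.continuous_ofReal.comp_aestronglyMeasurable h2.1.comp_snd)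
  rw [memLp_two_iff_integrable_sq_norm hm]
  refine ((h1.integrable_norm_pow two_ne_zero).mul_prod
    (h2.integrable_norm_pow two_ne_zero)).congr (ae_of_all _ fun p => ?_)
  simp [boxTransform, mul_pow]

lemma integral_inner_boxTransform (hf : IsFourierTransformOf f μ)
    (hμ : IsTempered μ) (B B' : Box d) :
    ∫ p, inner ℝ (boxTransform H B' p) (boxTransform H B p) ∂(μ.prod volume) =
      (∫ z in B.base.1, ∫ z' in B'.base.1, f (z - z')) *
        ∫ s, kernelInt H B.left B.right s * kernelInt H B'.left B'.right s := by
  have := hμ.sigmaFinite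
  have h1 := integral_indFourier_mul_conj hf hμ B.base.2.1 B'.base.2.1 B.base.2.2 B'.base.2.2
  have h2 := integral_re (integrable_indFourier_mul_conj hf hμ B.base B'.base)
  rw [h1] at h2
  simp only [RCLike.re_eq_complex_re, Complex.ofReal_re] at h2
  rw [← h2, ← integral_prod_mul]
  refine integral_congr_ae (ae_of_all _ fun p => ?_)
  simp only [boxTransform, Complex.inner, map_mul, Complex.conj_ofReal]
  rw [show indFourier B.base.1 p.1 * (kernelInt H B.left B.right p.2 : ℂ) *
    ((starRingEnd ℂ) (indFourier B'.base.1 p.1) * (kernelInt H B'.left B'.right p.2 : ℂ)) =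
    ((kernelInt H B.left B.right p.2 * kernelInt H B'.left B'.right p.2 : ℝ) : ℂ) *
      (indFourier B.base.1 p.1 * (starRingEnd ℂ) (indFourier B'.base.1 p.1)) by
        push_cast; ring, Complex.re_ofReal_mul, mul_comm]

lemma IsFractionalColoredNoise.memLp (hW : IsFractionalColoredNoise H f W P) (t : ℝ)
    (A : BoundedBorel d) : MemLp (W t A) 2 P :=
  (hW.gaussian.hasGaussianLaw_eval (t, A)).memLp_two

lemma memLp_boxNoise (hW : IsFractionalColoredNoise H f W P) (B : Box d) :
    MemLp (boxNoise W B) 2 P :=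
  (hW.memLp B.right B.base).sub (hW.memLp B.left B.base)

lemma integral_boxNoise_mul (hW : IsFractionalColoredNoise H f W P) (B B' : Box d) :
    ∫ ω, boxNoise W B ω * boxNoise W B' ω ∂P =
      (fbmCov H B.right B'.right - fbmCov H B.right B'.left - fbmCov H B.left B'.right +
        fbmCov H B.left B'.left) * ∫ z in B.base.1, ∫ z' in B'.base.1, f (z - z') := by
  have hi : ∀ s t, Integrable (fun ω => W s B.base ω * W t B'.base ω) P := fun s t =>
    (hW.memLp s B.base).integrable_mul (hW.memLp t B'.base)
  have hi2 : ∀ s t t', Integrable (fun ω => W s B.base ω * W t B'.base ω -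
      W s B.base ω * W t' B'.base ω) P := fun s t t' => (hi s t).sub (hi s t')
  have h : ∀ ω, boxNoise W B ω * boxNoise W B' ω =
      (W B.right B.base ω * W B'.right B'.base ω - W B.right B.base ω * W B'.left B'.base ω) -
      (W B.left B.base ω * W B'.right B'.base ω - W B.left B.base ω * W B'.left B'.base ω) := by
    intro ω; simp only [boxNoise]; ring
  simp_rw [h]
  rw [integral_sub (hi2 _ _ _) (hi2 _ _ _), integral_sub (hi _ _) (hi _ _),
    integral_sub (hi _ _) (hi _ _)]
  simp only [hW.covariance]
  ring

/-- Both Gram matrices split into time times space. The time factors agree up to the constant by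
`integral_kernelInt_mul`, the space factors by Plancherel. The complex $L^2$ space is used as a real
Hilbert space, so only real parts enter. -/
lemma gram_boxNoise (hH : 1 / 2 < H) (hH1 : H < 1) (hf : IsFourierTransformOf f μ)
    (hμ : IsTempered μ) (hW : IsFractionalColoredNoise H f W P) (B B' : Box d) :
    inner ℝ ((memLp_boxNoise hW B).toLp _) ((memLp_boxNoise hW B').toLp _) =
      (H * (2 * H - 1) / (kernelConst H).toReal) *
        inner ℝ ((memLp_boxTransform hH hH1 hf hμ B).toLp _)
          ((memLp_boxTransform hH hH1 hf hμ B').toLp _) := by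
  have hc := kernelConst_toReal_pos hH hH1
  have e1 : inner ℝ ((memLp_boxNoise hW B).toLp _) ((memLp_boxNoise hW B').toLp _) =
      ∫ ω, boxNoise W B ω * boxNoise W B' ω ∂P := by
    rw [L2.inner_def]
    refine integral_congr_ae ?_
    filter_upwards [(memLp_boxNoise hW B).coeFn_toLp, (memLp_boxNoise hW B').coeFn_toLp]
      with ω h1 h2
    rw [h1, h2]
    simp [mul_comm]
  have e2 : inner ℝ ((memLp_boxTransform hH hH1 hf hμ B').toLp _)
      ((memLp_boxTransform hH hH1 hf hμ B).toLp _) =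
      ∫ p, inner ℝ (boxTransform H B' p) (boxTransform H B p) ∂(μ.prod volume) := by
    rw [L2.inner_def]
    refine integral_congr_ae ?_
    filter_upwards [(memLp_boxTransform hH hH1 hf hμ B).coeFn_toLp,
      (memLp_boxTransform hH hH1 hf hμ B').coeFn_toLp] with ω h1 h2
    rw [h1, h2]
  rw [e1, real_inner_comm, e2, integral_inner_boxTransform hf hμ, integral_boxNoise_mul hW,
    div_mul_eq_mul_div, eq_div_iff hc.ne']
  linear_combination -(∫ z in B.base.1, ∫ z' in B'.base.1, f (z - z')) *
    integral_kernelInt_mul hH B.left_le_right B'.left_le_right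

lemma exists_noise_operator (hH : 1 / 2 < H) (hH1 : H < 1) (hf : IsFourierTransformOf f μ)
    (hμ : IsTempered μ) (hW : IsFractionalColoredNoise H f W P) :
    ∃ A : Lp ℂ 2 (μ.prod (volume : Measure ℝ)) →L[ℝ] Lp ℝ 2 P, ∀ B : Box d,
      A ((memLp_boxTransform hH hH1 hf hμ B).toLp _) = (memLp_boxNoise hW B).toLp _ := by
  refine exists_clm_of_gram _ _ (K := H * (2 * H - 1) / (kernelConst H).toReal) ?_
    (gram_boxNoise hH hH1 hf hμ hW)
  have := kernelConst_toReal_pos hH hH1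
  have : 0 < H * (2 * H - 1) := mul_pos (by linarith) (by linarith)
  positivity

end

/-! ### Elementary integrands and the passage to Wiener integrals -/

section

variable {Ω : Type*} {d : ℕ} {H : ℝ} {f : Space d → ℝ} {μ : Measure (Space d)}
  {W : ℝ → BoundedBorel d → Ω → ℝ}

lemma fourier_add {g h : Space d → ℂ} (hg : Integrable g) (hh : Integrable h) (ξ : Space d) :
    fourier (fun y => g y + h y) ξ = fourier g ξ + fourier h ξ := by
  have hb : ∀ {k : Space d → ℂ}, Integrable k → Integrable fun x =>
      Complex.exp (-(Complex.I * ((inner ℝ ξ x : ℝ) : ℂ))) * k x := fun hk =>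
    hk.bdd_mul (c := 1) (Continuous.aestronglyMeasurable (by fun_prop))
      (ae_of_all _ fun x => (norm_exp_neg_I_mul _).le)
  simp only [fourier, mul_add]
  exact integral_add (hb hg) (hb hh)

lemma fourier_const_mul (c : ℂ) (g : Space d → ℂ) (ξ : Space d) :
    fourier (fun y => c * g y) ξ = c * fourier g ξ := by
  simp only [fourier, ← integral_const_mul]
  congr 1; ext x; ring

lemma Elementary.toFun_zero : Elementary.toFun (0 : Elementary d) = fun _ _ => 0 := by
  ext u y; simp [Elementary.toFun]

lemma Elementary.toFun_add (φ ψ : Elementary d) :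
    Elementary.toFun (φ + ψ) = fun u y => φ.toFun u y + ψ.toFun u y := by
  ext u y
  exact Finsupp.sum_add_index' (by simp) (fun _ _ _ => by ring)

lemma Elementary.toFun_single (B : Box d) (c : ℝ) :
    Elementary.toFun (Finsupp.single B c) =
      fun u y => c * ((Set.Ioc B.left B.right).indicator 1 u * B.base.1.indicator 1 y) := by
  ext u y
  exact Finsupp.sum_single_index (by simp)

lemma Elementary.integral_add (φ ψ : Elementary d) (ω : Ω) :
    Elementary.integral W (φ + ψ) ω = φ.integral W ω + ψ.integral W ω :=
  Finsupp.sum_add_index' (by simp) (fun _ _ _ => by ring)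

lemma Elementary.integral_single (B : Box d) (c : ℝ) (ω : Ω) :
    Elementary.integral W (Finsupp.single B c) ω = c * boxNoise W B ω :=
  Finsupp.sum_single_index (by simp)

lemma Elementary.measurable_and_integrable (φ : Elementary d) :
    (Measurable fun p : ℝ × Space d => φ.toFun p.1 p.2) ∧ ∀ u, Integrable (φ.toFun u) := by
  induction φ using Finsupp.induction_linear with
  | zero =>
    rw [Elementary.toFun_zero]
    exact ⟨measurable_const, fun u => integrable_zero _ _ _⟩
  | add φ ψ hφ hψ =>
    rw [Elementary.toFun_add]
    exact ⟨hφ.1.add hψ.1, fun u => (hφ.2 u).add (hψ.2 u)⟩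
  | single B c =>
    rw [Elementary.toFun_single]
    refine ⟨?_, fun u => ?_⟩
    · exact (((measurable_one.indicator measurableSet_Ioc).comp measurable_fst).mul
        ((measurable_one.indicator B.base.2.1).comp measurable_snd)).const_mul c
    · refine Integrable.const_mul (Integrable.const_mul ?_ _) c
      exact (integrable_indicator_iff B.base.2.1).2
        (integrableOn_const B.base.2.2.measure_lt_top.ne)

lemma spaceFourier_single (B : Box d) (c : ℝ) (u : ℝ) (ξ : Space d) :
    spaceFourier (Elementary.toFun (Finsupp.single B c)) u ξ =
      (c : ℂ) * (((Set.Ioc B.left B.right).indicator 1 u : ℝ) : ℂ) * indFourier B.base.1 ξ := by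
  rw [spaceFourier, Elementary.toFun_single, indFourier, ← fourier_const_mul]
  congr 1
  ext y
  push_cast
  ring

lemma spaceFourier_add (φ ψ : Elementary d) (u : ℝ) (ξ : Space d) :
    spaceFourier (Elementary.toFun (φ + ψ)) u ξ =
      spaceFourier φ.toFun u ξ + spaceFourier ψ.toFun u ξ := by
  have h1 : Integrable fun y => (φ.toFun u y : ℂ) := (φ.measurable_and_integrable.2 u).ofReal
  have h2 : Integrable fun y => (ψ.toFun u y : ℂ) := (ψ.measurable_and_integrable.2 u).ofReal
  rw [spaceFourier, spaceFourier, spaceFourier, Elementary.toFun_add, ← fourier_add h1 h2]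
  simp only [Complex.ofReal_add]

/-- For one box the absolute transform is a product of a function of `ξ` and a function of `s`, each
square integrable; sums follow from `IsTransformable.of_norm_le`. -/
lemma Elementary.isTransformable (hH : 1 / 2 < H) (hH1 : H < 1) (hf : IsFourierTransformOf f μ)
    (hμ : IsTempered μ) (φ : Elementary d) : IsTransformable H μ (spaceFourier φ.toFun) := by
  have hm : ∀ φ : Elementary d, Measurable fun p : ℝ × Space d => spaceFourier φ.toFun p.1 p.2 :=
    fun φ => measurable_spaceFourier φ.measurable_and_integrable.1
  induction φ using Finsupp.induction_linear with
  | zero =>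
    refine ⟨hm 0, ?_⟩
    simp [Elementary.toFun_zero, spaceFourier, fourier]
  | add φ ψ hφ hψ =>
    refine hφ.of_norm_le hψ (hm _) (ae_of_all _ fun u ξ => ?_)
    rw [spaceFourier_add]
    exact norm_add_le _ _
  | single B c =>
    refine ⟨hm _, ?_⟩
    have h1 : ∀ ξ s, ∫⁻ u, ENNReal.ofReal (fracKernel H u s) *
        ‖spaceFourier (Elementary.toFun (Finsupp.single B c)) u ξ‖ₑ =
        (‖(c : ℂ)‖ₑ * ‖indFourier B.base.1 ξ‖ₑ) *
          ENNReal.ofReal (kernelInt H B.left B.right s) := by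
      intro ξ s
      rw [ofReal_kernelInt hH, ← lintegral_const_mul' _ _
        (ENNReal.mul_ne_top enorm_ne_top enorm_ne_top), ← lintegral_indicator measurableSet_Ioc]
      refine lintegral_congr fun u => ?_
      rw [spaceFourier_single]
      by_cases hu : u ∈ Set.Ioc B.left B.right
      · simp only [Set.indicator_of_mem hu, Pi.one_apply, Complex.ofReal_one, mul_one, enorm_mul]
        ring
      · simp [hu]
    have hκ : Measurable fun s => ENNReal.ofReal (kernelInt H B.left B.right s) ^ 2 :=
      (measurable_kernelInt H B.left B.right).ennreal_ofReal.pow_const 2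
    have h2 : ∫⁻ s, ENNReal.ofReal (kernelInt H B.left B.right s) ^ 2 < ∞ := by
      simp_rw [sq]
      rw [lintegral_kernelInt_mul hH B.left_le_right]
      exact ENNReal.mul_lt_top (kernelConst_lt_top hH hH1) ENNReal.ofReal_lt_top
    have h3 : ∫⁻ ξ, ‖indFourier B.base.1 ξ‖ₑ ^ 2 ∂μ < ∞ := by
      have := (memLp_indFourier hf hμ B.base.2.1 B.base.2.2).2
      rw [eLpNorm_lt_top_iff_lintegral_rpow_enorm_lt_top two_ne_zero ENNReal.ofNat_ne_top] at this
      simpa using this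
    simp_rw [h1, mul_pow]
    simp_rw [lintegral_const_mul _ hκ]
    rw [lintegral_mul_const' _ _ h2.ne, lintegral_const_mul' _ _ (ENNReal.pow_ne_top enorm_ne_top)]
    exact ENNReal.mul_lt_top (ENNReal.mul_lt_top (ENNReal.pow_lt_top enorm_lt_top) h3) h2

lemma timeTransform_single (B : Box d) (c : ℝ) (p : Space d × ℝ) :
    timeTransform H (spaceFourier (Elementary.toFun (Finsupp.single B c))) p =
      (c : ℂ) * boxTransform H B p := by
  rw [timeTransform, boxTransform, kernelInt, ← integral_complex_ofReal, ← integral_const_mul,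
    ← integral_const_mul, ← integral_indicator measurableSet_Ioc]
  refine integral_congr_ae (ae_of_all _ fun u => ?_)
  simp only [spaceFourier_single]
  by_cases hu : u ∈ Set.Ioc B.left B.right
  · simp only [Set.indicator_of_mem hu, Pi.one_apply, Complex.ofReal_one, mul_one]
    ring
  · simp [hu]

lemma timeTransform_elementary (hH : 1 / 2 < H) (hH1 : H < 1) (hf : IsFourierTransformOf f μ)
    (hμ : IsTempered μ) (φ : Elementary d) :
    (Elementary.isTransformable hH hH1 hf hμ φ).memLp.toLp _ =
      Finsupp.linearCombination ℝ
        (fun B => (memLp_boxTransform hH hH1 hf hμ B).toLp (boxTransform H B)) φ := by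
  induction φ using Finsupp.induction_linear with
  | zero =>
    rw [map_zero]
    refine Lp.eq_zero_iff_ae_eq_zero.2 ((MemLp.coeFn_toLp _).trans (ae_of_all _ fun p => ?_))
    simp [Elementary.toFun_zero, spaceFourier, fourier, timeTransform]
  | add φ ψ hφ hψ =>
    rw [map_add, ← hφ, ← hψ, ← MemLp.toLp_add, MemLp.toLp_eq_toLp_iff]
    have := timeTransform_add_mul_ae (Elementary.isTransformable hH hH1 hf hμ φ)
      (Elementary.isTransformable hH hH1 hf hμ ψ) 1
      (c := spaceFourier (Elementary.toFun (φ + ψ)))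
      (ae_of_all _ fun u ξ => by rw [spaceFourier_add, one_mul])
    filter_upwards [this] with p hp
    rw [hp, one_mul, Pi.add_apply]
  | single B c =>
    rw [Finsupp.linearCombination_single, ← MemLp.toLp_const_smul, MemLp.toLp_eq_toLp_iff]
    refine ae_of_all _ fun p => ?_
    rw [timeTransform_single]
    simp

variable [MeasurableSpace Ω] {P : Measure Ω}

lemma memLp_elementaryIntegral (hW : IsFractionalColoredNoise H f W P) (φ : Elementary d) :
    MemLp (φ.integral W) 2 P := by
  induction φ using Finsupp.induction_linear with
  | zero =>
    have : Elementary.integral W (0 : Elementary d) = 0 := by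
      ext ω; simp [Elementary.integral]
    rw [this]
    exact MemLp.zero
  | add φ ψ hφ hψ =>
    have : Elementary.integral W (φ + ψ) =
        Elementary.integral W φ + Elementary.integral W ψ :=
      funext fun ω => Elementary.integral_add φ ψ ω
    rw [this]
    exact hφ.add hψ
  | single B c =>
    have : Elementary.integral W (Finsupp.single B c) = fun ω => c * boxNoise W B ω :=
      funext fun ω => Elementary.integral_single B c ω
    rw [this]
    exact (memLp_boxNoise hW B).const_mul c

lemma toLp_elementaryIntegral (hW : IsFractionalColoredNoise H f W P) (φ : Elementary d) :
    (memLp_elementaryIntegral hW φ).toLp _ =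
      Finsupp.linearCombination ℝ (fun B => (memLp_boxNoise hW B).toLp (boxNoise W B)) φ := by
  induction φ using Finsupp.induction_linear with
  | zero =>
    rw [map_zero]
    refine Lp.eq_zero_iff_ae_eq_zero.2 ((MemLp.coeFn_toLp _).trans (ae_of_all _ fun p => ?_))
    simp [Elementary.integral]
  | add φ ψ hφ hψ =>
    rw [map_add, ← hφ, ← hψ, ← MemLp.toLp_add, MemLp.toLp_eq_toLp_iff]
    exact ae_of_all _ fun ω => Elementary.integral_add φ ψ ω
  | single B c =>
    rw [Finsupp.linearCombination_single, ← MemLp.toLp_const_smul, MemLp.toLp_eq_toLp_iff]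
    exact ae_of_all _ fun ω => Elementary.integral_single B c ω

/-- Converts convergence in `normSq` into $L^2$ convergence of transforms. The isometry is applied
to the difference, whose absolute integrability comes from that of both terms. -/
lemma norm_sq_sub_eq_normSq (hH : 1 / 2 < H) (hH1 : H < 1) (hf : IsFourierTransformOf f μ)
    (hμ : IsTempered μ) {g : ℝ → Space d → ℝ} (hg : IsAdmissible H μ g) (φ : Elementary d) :
    ‖(Elementary.isTransformable hH hH1 hf hμ φ).memLp.toLp _ -
        (hg.isTransformable hH hH1).memLp.toLp _‖ ^ 2 =
      (kernelConst H).toReal / (H * (2 * H - 1)) *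
        normSq H μ fun u y => φ.toFun u y - g u y := by
  have := hμ.sigmaFinite
  have hφt := Elementary.isTransformable hH hH1 hf hμ φ
  have hgt := hg.isTransformable hH hH1
  have hsub : ∀ᵐ u, ∀ ξ, spaceFourier (fun u y => φ.toFun u y - g u y) u ξ =
      spaceFourier φ.toFun u ξ + (-1) * spaceFourier g u ξ := by
    filter_upwards [hg.integrable] with u hu ξ
    simp only [spaceFourier]
    have h1 : Integrable fun y => (φ.toFun u y : ℂ) := (φ.measurable_and_integrable.2 u).ofReal
    have h2 : Integrable fun y => (-1) * (g u y : ℂ) := (Integrable.ofReal hu).const_mul (-1)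
    rw [← fourier_const_mul, ← fourier_add h1 h2]
    congr 1
    ext y
    push_cast; ring
  have hct : IsTransformable H μ (spaceFourier fun u y => φ.toFun u y - g u y) := by
    refine hφt.of_norm_le hgt
      (measurable_spaceFourier (φ.measurable_and_integrable.1.sub hg.measurable)) ?_
    filter_upwards [hsub] with u hu ξ
    rw [hu, neg_one_mul, ← sub_eq_add_neg]
    exact norm_sub_le _ _
  have h1 := timeTransform_add_mul_ae hφt hgt (-1) hsub
  have h2 := hct.integral_norm_sq
  have hHne : H * (2 * H - 1) ≠ 0 := (mul_pos (by linarith) (by linarith)).ne'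
  rw [normSq, ← MemLp.toLp_sub, ← real_inner_self_eq_norm_sq, L2.inner_def,
    ← mul_assoc, div_mul_cancel₀ _ hHne, ← h2]
  refine integral_congr_ae ?_
  filter_upwards [h1, (hφt.memLp.sub hgt.memLp).coeFn_toLp] with p h3 h4
  rw [h4, h3, real_inner_self_eq_norm_sq, Pi.sub_apply, neg_one_mul, sub_eq_add_neg]

/-- Wiener integrals are the images of the time transforms of their integrands under a bounded
operator of `L²` spaces. -/
theorem exists_wiener_operator (hH : 1 / 2 < H) (hH1 : H < 1) (hf : IsFourierTransformOf f μ)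
    (hμ : IsTempered μ) (hW : IsFractionalColoredNoise H f W P) :
    ∃ A : Lp ℂ 2 (μ.prod (volume : Measure ℝ)) →L[ℝ] Lp ℝ 2 P,
      ∀ (g : ℝ → Space d → ℝ) (X : Ω → ℝ) (hX : IsWienerIntegral H μ W P g X),
        A ((hX.1.isTransformable hH hH1).memLp.toLp _) = hX.2.1.toLp X := by
  obtain ⟨A, hA⟩ := exists_noise_operator hH hH1 hf hμ hW
  refine ⟨A, fun g X hX => ?_⟩
  obtain ⟨φ, hφ1, hφ2⟩ := hX.2.2
  -- Both sides are the same linear combination over boxes, so agreement on boxes is enough. The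
  -- images then have two limits, one by continuity of `A` and one by the definition of `X`, which
  -- must coincide.
  have hAφ : ∀ n, A ((Elementary.isTransformable hH hH1 hf hμ (φ n)).memLp.toLp _) =
      (memLp_elementaryIntegral hW (φ n)).toLp _ := by
    intro n
    rw [timeTransform_elementary hH hH1 hf hμ, toLp_elementaryIntegral hW, Finsupp.linearCombination_apply,
      Finsupp.linearCombination_apply, map_finsuppSum]
    simp only [map_smul, hA]
  have h1 : Tendsto (fun n => (Elementary.isTransformable hH hH1 hf hμ (φ n)).memLp.toLp _) atTop
      (𝓝 ((hX.1.isTransformable hH hH1).memLp.toLp _)) := by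
    rw [tendsto_iff_norm_sub_tendsto_zero]
    have h2 := (hφ1.const_mul ((kernelConst H).toReal / (H * (2 * H - 1)))).sqrt
    rw [mul_zero, Real.sqrt_zero] at h2
    refine h2.congr fun n => ?_
    rw [← norm_sq_sub_eq_normSq hH hH1 hf hμ hX.1 (φ n), Real.sqrt_sq (norm_nonneg _)]
  have h3 := (A.continuous.tendsto _).comp h1
  refine tendsto_nhds_unique h3 ?_
  simp only [Function.comp_def, hAφ]
  rw [tendsto_iff_norm_sub_tendsto_zero]
  have h4 := (ENNReal.tendsto_toReal ENNReal.zero_ne_top).comp hφ2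
  rw [ENNReal.toReal_zero] at h4
  refine h4.congr fun n => ?_
  rw [← MemLp.toLp_sub, Lp.norm_toLp]
  rfl

end

/-! ### The Fourier transform of the remainder kernel -/

section

variable {d : ℕ}

lemma integrable_and_fourier_heatKernel {t : ℝ} (ht : 0 < t) (x : Space d) :
    Integrable (fun y => (heatKernel t (x - y) : ℂ)) ∧ ∀ ξ,
      fourier (fun y => (heatKernel t (x - y) : ℂ)) ξ =
        Complex.exp (-(Complex.I * ((inner ℝ ξ x : ℝ) : ℂ))) *
          (Real.exp (-t * (‖ξ‖ ^ 2 / 2)) : ℂ) := by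
  have hb : 0 < ((1 / (2 * t) : ℝ) : ℂ).re := by rw [Complex.ofReal_re]; positivity
  have hpos : 0 < 2 * Real.pi * t := by positivity
  have hker : ∀ z : Space d, (heatKernel t z : ℂ) = (((2 * Real.pi * t) ^ (-(d : ℝ) / 2) : ℝ) : ℂ) *
      Complex.exp (-((1 / (2 * t) : ℝ) : ℂ) * (‖z‖ : ℂ) ^ 2) := by
    intro z
    rw [heatKernel, if_pos ht, Complex.ofReal_mul, Complex.ofReal_exp]
    congr 2
    push_cast
    ring
  refine ⟨?_, fun ξ => ?_⟩
  · have h := (GaussianFourier.integrable_cexp_neg_mul_sq_norm_add hb 0 (0 : Space d)).const_mul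
      (((2 * Real.pi * t) ^ (-(d : ℝ) / 2) : ℝ) : ℂ)
    have h2 : Integrable fun z : Space d => (heatKernel t z : ℂ) := by
      refine h.congr (ae_of_all _ fun z => ?_)
      simp only [hker, zero_mul, add_zero]
    exact h2.comp_sub_left x
  · have h := GaussianFourier.integral_cexp_neg_mul_sq_norm_add hb Complex.I ξ
    rw [fourier, ← integral_sub_left_eq_self _ volume x]
    have h1 : ∀ z : Space d, Complex.exp (-(Complex.I * ((inner ℝ ξ (x - z) : ℝ) : ℂ))) *
        (heatKernel t (x - (x - z)) : ℂ) =
        (Complex.exp (-(Complex.I * ((inner ℝ ξ x : ℝ) : ℂ))) *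
          (((2 * Real.pi * t) ^ (-(d : ℝ) / 2) : ℝ) : ℂ)) *
          Complex.exp (-((1 / (2 * t) : ℝ) : ℂ) * (‖z‖ : ℂ) ^ 2 +
            Complex.I * ((inner ℝ ξ z : ℝ) : ℂ)) := by
      intro z
      rw [sub_sub_cancel, hker, Complex.exp_add, inner_sub_right,
        show -(Complex.I * ((inner ℝ ξ x - inner ℝ ξ z : ℝ) : ℂ)) =
          -(Complex.I * ((inner ℝ ξ x : ℝ) : ℂ)) + Complex.I * ((inner ℝ ξ z : ℝ) : ℂ) by
            push_cast; ring, Complex.exp_add]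
      ring
    simp_rw [h1]
    rw [integral_const_mul, h, mul_assoc]
    congr 1
    have h2 : ((Real.pi : ℂ) / ((1 / (2 * t) : ℝ) : ℂ)) ^
        ((Module.finrank ℝ (Space d) : ℂ) / 2) =
        (((2 * Real.pi * t) ^ ((d : ℝ) / 2) : ℝ) : ℂ) := by
      rw [Complex.ofReal_cpow hpos.le, finrank_euclideanSpace, Fintype.card_fin]
      push_cast
      congr 1
      field_simp
    rw [h2, ← mul_assoc, ← Complex.ofReal_mul, ← Real.rpow_add hpos,
      show -(d : ℝ) / 2 + (d : ℝ) / 2 = 0 by ring, Real.rpow_zero, Complex.ofReal_one, one_mul,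
      Complex.ofReal_exp]
    congr 1
    rw [Complex.I_sq]
    have : (t : ℂ) ≠ 0 := by exact_mod_cast ht.ne'
    push_cast
    field_simp
    ring

/-- The common factor of the Fourier transforms of the remainder kernels. -/
def remainderFactor (x : Space d) (u : ℝ) (ξ : Space d) : ℂ :=
  if u < 0 then Complex.exp (-(Complex.I * ((inner ℝ ξ x : ℝ) : ℂ))) *
    (Real.exp (u * (‖ξ‖ ^ 2 / 2)) : ℂ) else 0

/-- Semigroup property: $e^{-(t-u)\lambda}=e^{u\lambda}e^{-t\lambda}$ separates $t$ from $u$. Time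
$u=0$ is excluded because `heatKernel` vanishes at time $0$ instead of being a point mass; it is a
null set for the time transform. -/
lemma spaceFourier_remainderKernel (x : Space d) {t u : ℝ} (ht : 0 ≤ t) (hu : u ≠ 0)
    (ξ : Space d) : spaceFourier (remainderKernel x t) u ξ =
      remainderFactor x u ξ * ((Real.exp (-t * (‖ξ‖ ^ 2 / 2)) - 1 : ℝ) : ℂ) := by
  rcases lt_or_gt_of_ne hu with hu | hu
  · obtain ⟨i1, f1⟩ := integrable_and_fourier_heatKernel (d := d) (t := t - u) (by linarith) x
    obtain ⟨i2, f2⟩ := integrable_and_fourier_heatKernel (d := d) (t := -u) (by linarith) x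
    have h : (fun y => (remainderKernel x t u y : ℂ)) = fun y =>
        (heatKernel (t - u) (x - y) : ℂ) + (-1) * (heatKernel (-u) (x - y) : ℂ) := by
      ext y
      rw [remainderKernel, if_pos hu.le]
      push_cast; ring
    rw [spaceFourier, h, fourier_add i1 (i2.const_mul (-1)), fourier_const_mul, f1, f2,
      remainderFactor, if_pos hu, show -(t - u) * (‖ξ‖ ^ 2 / 2) =
        u * (‖ξ‖ ^ 2 / 2) + -t * (‖ξ‖ ^ 2 / 2) by ring, Real.exp_add, neg_neg]
    push_cast
    ring
  · have h : (fun y => (remainderKernel x t u y : ℂ)) = fun y => 0 := by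
      ext y
      rw [remainderKernel, if_neg (not_le.2 hu), Complex.ofReal_zero]
    rw [spaceFourier, h, remainderFactor, if_neg (not_lt.2 hu.le)]
    simp [fourier]

lemma timeTransform_remainderKernel (H : ℝ) (x : Space d) {t : ℝ} (ht : 0 ≤ t)
    (p : Space d × ℝ) : timeTransform H (spaceFourier (remainderKernel x t)) p =
      timeTransform H (remainderFactor x) p *
        ((Real.exp (-t * (‖p.1‖ ^ 2 / 2)) - 1 : ℝ) : ℂ) := by
  rw [timeTransform, timeTransform, ← integral_mul_const]
  refine integral_congr_ae ?_
  filter_upwards [volume.ae_ne 0] with u hu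
  rw [spaceFourier_remainderKernel x ht hu, mul_assoc]

end

/-! ### Expansion in powers of `1 - t / b` -/

/-- The coefficients of the expansion of `exp (-(1 - q) b λ) - 1` in powers of `q`. -/
def expCoeff (b : ℝ) (n : ℕ) (l : ℝ) : ℝ :=
  (b * l) ^ n / n.factorial * Real.exp (-b * l) - if n = 0 then 1 else 0

lemma hasSum_expCoeff (b l q : ℝ) :
    HasSum (fun n => q ^ n * expCoeff b n l) (Real.exp (-((1 - q) * b) * l) - 1) := by
  have h1 : HasSum (fun n : ℕ => (q * (b * l)) ^ n / n.factorial) (Real.exp (q * (b * l))) := by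
    have := NormedSpace.expSeries_div_hasSum_exp (𝔸 := ℝ) (q * (b * l))
    rwa [← Real.exp_eq_exp_ℝ] at this
  have h2 := h1.mul_right (Real.exp (-b * l))
  rw [← Real.exp_add, show q * (b * l) + -b * l = -((1 - q) * b) * l by ring] at h2
  have h3 : HasSum (fun n : ℕ => if n = 0 then (1 : ℝ) else 0) 1 := by
    simpa using hasSum_ite_eq (0 : ℕ) (1 : ℝ)
  refine (h2.sub h3).congr_fun fun n => ?_
  rw [expCoeff, mul_pow]
  split_ifs with hn
  · subst hn; ring
  · ring

/-- For $n\ge1$, keeping only the terms $0$ and $n$ of the exponential series gives $(bl)^n/n!\le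
e^{bl}-1$; multiplying by $e^{-bl}$ yields $1-e^{-bl}$, the modulus of the coefficient at $0$. The
bound keeps the decay at small $l$, needed where the common factor alone may fail to be square
integrable. -/
lemma abs_expCoeff_le {b l : ℝ} (hb : 0 ≤ b) (hl : 0 ≤ l) (n : ℕ) :
    |expCoeff b n l| ≤ |expCoeff b 0 l| := by
  have hbl : 0 ≤ b * l := mul_nonneg hb hl
  have h0 : |expCoeff b 0 l| = 1 - Real.exp (-b * l) := by
    have : Real.exp (-b * l) ≤ 1 := Real.exp_le_one_iff.2 (by linarith)
    rw [expCoeff, abs_of_nonpos] <;> simp <;> linarith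
  rcases Nat.eq_zero_or_pos n with rfl | hn
  · exact le_rfl
  rw [h0, expCoeff, if_neg hn.ne', sub_zero, abs_of_nonneg (by positivity)]
  have h1 : (b * l) ^ n / n.factorial ≤ Real.exp (b * l) - 1 := by
    have h := Real.sum_le_exp_of_nonneg hbl (n + 1)
    have h2 : ∑ i ∈ ({0, n} : Finset ℕ), (b * l) ^ i / i.factorial ≤
        ∑ i ∈ Finset.range (n + 1), (b * l) ^ i / i.factorial := by
      refine Finset.sum_le_sum_of_subset_of_nonneg (fun i hi => ?_) fun i _ _ => by positivity
      simp only [Finset.mem_insert, Finset.mem_singleton] at hi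
      rw [Finset.mem_range]; omega
    rw [Finset.sum_pair hn.ne] at h2
    simp only [pow_zero, Nat.factorial_zero, Nat.cast_one, div_one] at h2
    linarith
  calc (b * l) ^ n / n.factorial * Real.exp (-b * l)
      ≤ (Real.exp (b * l) - 1) * Real.exp (-b * l) :=
        mul_le_mul_of_nonneg_right h1 (Real.exp_pos _).le
    _ = 1 - Real.exp (-b * l) := by
        rw [sub_mul, one_mul, ← Real.exp_add, show b * l + -b * l = 0 by ring, Real.exp_zero]

lemma tsum_enorm_pow_smul_ne_top {E : Type*} [NormedAddCommGroup E] [NormedSpace ℝ E]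
    {c : ℕ → E} {M : ℝ} (hc : ∀ n, ‖c n‖ ≤ M) {q : ℝ} (hq : |q| < 1) :
    ∑' n, ‖q ^ n • c n‖ₑ ≠ ∞ := by
  rw [tsum_enorm_ne_top_iff_summable_norm]
  refine Summable.of_nonneg_of_le (fun n => norm_nonneg _) (fun n => ?_)
    ((summable_geometric_of_lt_one (abs_nonneg q) hq).mul_right M)
  rw [norm_smul, norm_pow, Real.norm_eq_abs]
  exact mul_le_mul_of_nonneg_left (hc n) (by positivity)

/-- Multiply the scalar expansion by the common factor `m`. All coefficients are dominated pointwise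
by the one at $n=0$, so they are uniformly bounded in $L^2$ and the series converges geometrically.
-/
lemma exists_remainder_expansion {d : ℕ} {H : ℝ} (hH : 1 / 2 < H) (hH1 : H < 1)
    {μ : Measure (Space d)} (x : Space d)
    (hadm : ∀ t, 0 ≤ t → IsAdmissible H μ (remainderKernel x t)) {b : ℝ} (hb : 0 < b) :
    ∃ (G : ℕ → Lp ℂ 2 (μ.prod (volume : Measure ℝ))) (M : ℝ), (∀ n, ‖G n‖ ≤ M) ∧
      ∀ (t : ℝ) (ht : 0 ≤ t), |1 - t / b| < 1 →
        ((hadm t ht).isTransformable hH hH1).memLp.toLp _ = ∑' n, (1 - t / b) ^ n • G n := by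
  let m := timeTransform H (remainderFactor x)
  let h : ℕ → Space d × ℝ → ℂ := fun n p => m p * (expCoeff b n (‖p.1‖ ^ 2 / 2) : ℂ)
  have hT0 := (((hadm b hb.le).isTransformable hH hH1).memLp)
  -- At $t=b$ one has $q=0$ and only the term $n=0$ survives; its square integrability is thus the
  -- admissibility of the kernel at time `b`. Nothing is claimed about `m` alone.
  have h0 : timeTransform H (spaceFourier (remainderKernel x b)) = h 0 := by
    ext p
    rw [timeTransform_remainderKernel H x hb.le]
    simp [h, m, expCoeff]
  rw [h0] at hT0
  have hle : ∀ n p, ‖h n p‖ ≤ ‖h 0 p‖ := by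
    intro n p
    simp only [h, norm_mul, Complex.norm_real]
    exact mul_le_mul_of_nonneg_left (abs_expCoeff_le hb.le (by positivity) n) (norm_nonneg _)
  have hmeasm : StronglyMeasurable m := by
    refine stronglyMeasurable_timeTransform (Measurable.ite ?_ ?_ measurable_const)
    · exact measurableSet_lt measurable_fst measurable_const
    · exact Continuous.measurable (by fun_prop)
  have hL : ∀ n, MemLp (h n) 2 (μ.prod volume) := fun n => by
    refine hT0.mono (StronglyMeasurable.aestronglyMeasurable ?_) (ae_of_all _ (hle n))
    refine hmeasm.mul (Continuous.stronglyMeasurable ?_)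
    unfold expCoeff
    fun_prop
  refine ⟨fun n => (hL n).toLp _, ‖(hL 0).toLp _‖, fun n => ?_, fun t ht hq => ?_⟩
  · refine Lp.norm_le_norm_of_ae_le ?_
    filter_upwards [(hL n).coeFn_toLp, (hL 0).coeFn_toLp] with p h1 h2
    rw [h1, h2]
    exact hle n p
  · apply Lp.ext
    have hbound : ∀ n, ‖(hL n).toLp _‖ ≤ ‖(hL 0).toLp _‖ := fun n => by
      refine Lp.norm_le_norm_of_ae_le ?_
      filter_upwards [(hL n).coeFn_toLp, (hL 0).coeFn_toLp] with p h1 h2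
      rw [h1, h2]
      exact hle n p
    have hsum := Lp.coeFn_tsum (tsum_enorm_pow_smul_ne_top hbound hq)
    have hsm : ∀ᵐ p ∂(μ.prod volume), ∀ n : ℕ,
        ((1 - t / b) ^ n • (hL n).toLp _ : Lp ℂ 2 (μ.prod (volume : Measure ℝ))) p =
          (1 - t / b) ^ n • h n p := by
      rw [ae_all_iff]
      intro n
      filter_upwards [Lp.coeFn_smul ((1 - t / b) ^ n) ((hL n).toLp _), (hL n).coeFn_toLp]
        with p h1 h2
      rw [h1, Pi.smul_apply, h2]
    filter_upwards [((hadm t ht).isTransformable hH hH1).memLp.coeFn_toLp, hsum, hsm]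
      with p h1 h2 h3
    rw [h1, h2, timeTransform_remainderKernel H x ht]
    simp only [h3]
    have h4 := (Complex.hasSum_ofReal.2
      (hasSum_expCoeff b (‖p.1‖ ^ 2 / 2) (1 - t / b))).mul_left (m p)
    rw [show (1 - (1 - t / b)) * b = t by field_simp; ring] at h4
    rw [← h4.tsum_eq]
    refine tsum_congr fun n => ?_
    simp only [h, Complex.real_smul]
    push_cast
    ring

/-! ### Modifications given by random power series -/

lemma contDiffOn_tsum_pow {c : ℕ → ℝ} {ρ : ℝ} (hρ : 0 < ρ) (hc : Summable fun n => ‖ρ ^ n * c n‖)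
    (k : ℕ) : ContDiffOn ℝ k (fun q => ∑' n, q ^ n * c n) (Metric.ball 0 ρ) := by
  let p := FormalMultilinearSeries.ofScalars ℝ c
  have hr : ENNReal.ofReal ρ ≤ p.radius := by
    refine p.le_radius_of_summable_norm (r := ρ.toNNReal) ?_
    refine hc.congr fun n => ?_
    rw [FormalMultilinearSeries.ofScalars_norm, Real.coe_toNNReal _ hρ.le, norm_mul, norm_pow,
      Real.norm_of_nonneg hρ.le, mul_comm]
  have hp := p.hasFPowerSeriesOnBall ((ENNReal.ofReal_pos.2 hρ).trans_le hr)
  have heq : p.sum = fun q => ∑' n, q ^ n * c n := by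
    ext q
    have := FormalMultilinearSeries.ofScalars_sum_eq c q
    rw [FormalMultilinearSeries.ofScalarsSum] at this
    rw [this]
    exact tsum_congr fun n => by rw [smul_eq_mul, mul_comm]
  rw [← heq]
  refine (hp.analyticOnNhd.contDiffOn (n := (k : WithTop ℕ∞)) ?_).mono ?_
  · exact Metric.isOpen_eball.uniqueDiffOn
  · rw [← Metric.eball_ofReal]
    exact Metric.eball_subset_eball hr

/-- Almost sure convergence at the single point $q=1-a/(2b)$ gives one exceptional null set for all
$t\in[a,b]$: off it, the radius of convergence exceeds every $|1-t/b|$ with $t$ in the interval. The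
identification with `Y t` is made for each $t$ separately. -/
lemma exists_contDiff_modification {Ω : Type*} [MeasurableSpace Ω] {P : Measure Ω}
    {Y : ℝ → Ω → ℝ} (hY : ∀ t, 0 ≤ t → MemLp (Y t) 2 P) {a b : ℝ} (ha : 0 < a) (hab : a ≤ b)
    {X : ℕ → Lp ℝ 2 P} {M : ℝ} (hX : ∀ n, ‖X n‖ ≤ M)
    (hYX : ∀ t (ht : 0 ≤ t), |1 - t / b| < 1 → (hY t ht).toLp _ = ∑' n, (1 - t / b) ^ n • X n)
    (k : ℕ) :
    ∃ Z : ℝ → Ω → ℝ, (∀ t, 0 ≤ t → Measurable (Z t)) ∧ (∀ t, 0 ≤ t → Z t =ᵐ[P] Y t) ∧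
      ∀ᵐ ω ∂P, ContDiffOn ℝ k (fun t => Z t ω) (Set.Icc a b) := by
  classical
  have hb : 0 < b := ha.trans_le hab
  have hXm : ∀ n, Measurable (X n : Ω → ℝ) := fun n => (Lp.stronglyMeasurable (X n)).measurable
  -- On $[a,b]$ the variable $q$ runs through $[0,1-a/b]$. Halving $a/b$ gives a radius strictly
  -- beyond this range and still below $1$, where the series converges in $L^2$.
  have hq : ∀ t ∈ Set.Icc a b, |1 - t / b| < 1 - a / (2 * b) := by
    intro t ht
    have h1 : t / b ≤ 1 := (div_le_one hb).2 ht.2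
    have h2 : a / b ≤ t / b := div_le_div_of_nonneg_right ht.1 hb.le
    have h3 : 0 < a / (2 * b) := by positivity
    have h4 : a / b = 2 * (a / (2 * b)) := by field_simp
    rw [abs_of_nonneg (by linarith)]
    linarith
  have hlt1 : 1 - a / (2 * b) < 1 := by
    have : 0 < a / (2 * b) := by positivity
    linarith
  have hρ : 0 < 1 - a / (2 * b) := (abs_nonneg _).trans_lt (hq b ⟨hab, le_rfl⟩)
  have hsmul : ∀ q : ℝ, ∀ᵐ ω ∂P, ∀ n : ℕ, (q ^ n • X n : Lp ℝ 2 P) ω = q ^ n * X n ω := by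
    intro q
    rw [ae_all_iff]
    intro n
    filter_upwards [Lp.coeFn_smul (q ^ n) (X n)] with ω h
    rw [h, Pi.smul_apply, smul_eq_mul]
  -- Outside $[a,b]$ no regularity is asked, so any measurable representative of `Y t` will do; the
  -- value at negative times is arbitrary.
  refine ⟨fun t ω => if t ∈ Set.Icc a b then ∑' n, (1 - t / b) ^ n * X n ω else
    if ht : 0 ≤ t then (hY t ht).1.mk (Y t) ω else 0, fun t ht => ?_, fun t ht => ?_, ?_⟩
  · by_cases h : t ∈ Set.Icc a b
    · simp only [h, if_true]
      exact Measurable.tsum fun n => (hXm n).const_mul _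
    · simp only [h, if_false, ht, dif_pos]
      exact (hY t ht).1.stronglyMeasurable_mk.measurable
  · by_cases h : t ∈ Set.Icc a b
    · simp only [h, if_true]
      have hq1 := (hq t h).trans hlt1
      filter_upwards [Lp.coeFn_tsum (tsum_enorm_pow_smul_ne_top hX hq1), (hY t ht).coeFn_toLp,
        hsmul (1 - t / b)] with ω h1 h2 h3
      rw [← h2, hYX t ht hq1, h1]
      simp only [h3]
    · simp only [h, if_false, ht, dif_pos]
      exact (hY t ht).1.ae_eq_mk.symm
  · have hsum := Lp.hasSum_coeFn_tsum (tsum_enorm_pow_smul_ne_top hX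
      (q := 1 - a / (2 * b)) (by rwa [abs_of_pos hρ]))
    filter_upwards [hsum, hsmul (1 - a / (2 * b))] with ω h1 h2
    simp only [h2] at h1
    have h3 := contDiffOn_tsum_pow hρ h1.summable.norm k
    have h4 : ContDiffOn ℝ k (fun t => ∑' n, (1 - t / b) ^ n * X n ω) (Set.Icc a b) := by
      refine h3.comp (t := Metric.ball 0 (1 - a / (2 * b))) (f := fun t : ℝ => 1 - t / b)
        (ContDiff.contDiffOn (by fun_prop)) fun t ht => ?_
      rw [mem_ball_zero_iff, Real.norm_eq_abs]
      exact hq t ht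
    exact h4.congr fun t ht => if_pos ht

end FracHeat

end

theorem theorem2 {Ω : Type*} [MeasurableSpace Ω] (P : Measure Ω) [IsProbabilityMeasure P]
    (d : ℕ) (H α : ℝ) (hH : 1 / 2 < H) (hH1 : H < 1) (hα : 0 < α) (hαd : α < d)
    (μ : Measure (Space d)) (hμ : IsTempered μ) (hμα : AsympRiesz μ α)
    (hex : ExistenceCondition H μ)
    (f : Space d → ℝ) (hf : IsFourierTransformOf f μ)
    (W : ℝ → BoundedBorel d → Ω → ℝ) (hW : IsFractionalColoredNoise H f W P)
    (x : Space d) (Y : ℝ → Ω → ℝ)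
    (hY : ∀ t, 0 ≤ t → IsWienerIntegral H μ W P (remainderKernel x t) (Y t))
    (a b : ℝ) (ha : 0 < a) (hab : a ≤ b) (k : ℕ) (hk : 1 ≤ k) :
    ∃ Z : ℝ → Ω → ℝ,
      (∀ t, 0 ≤ t → Measurable (Z t)) ∧
      (∀ t, 0 ≤ t → Z t =ᵐ[P] Y t) ∧
      ∀ᵐ ω ∂P, ContDiffOn ℝ k (fun t => Z t ω) (Set.Icc a b) := by
  obtain ⟨A, hA⟩ := exists_wiener_operator hH hH1 hf hμ hW
  obtain ⟨G, M, hGM, hG⟩ := exists_remainder_expansion hH hH1 x (fun t ht => (hY t ht).1)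
    (ha.trans_le hab)
  refine exists_contDiff_modification (fun t ht => (hY t ht).2.1) ha hab
    (X := fun n => A (G n)) (M := ‖A‖ * M)
    (fun n => (A.le_opNorm _).trans (mul_le_mul_of_nonneg_left (hGM n) (norm_nonneg _)))
    (fun t ht hq => ?_) k
  -- Summability in $L^2(\mu\otimes ds)$ lets the bounded operator `A` act term by term, so the
  -- coefficients of the random series are `A (G n)`.
  have hs : Summable fun n => (1 - t / b) ^ n • G n :=
    Summable.of_enorm (tsum_enorm_pow_smul_ne_top hGM hq)
  rw [← hA _ _ (hY t ht), hG t ht hq, A.map_tsum hs]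
  simp only [map_smul]
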